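/- **Prime Kerr data.** Fix real $m_0,a$ and put $\Delta=r^2-2m_0r+a^2$, $\rho^2=r^2+a^2\cos^2\vartheta$, $\overline A=-\rho^{-2}(\Delta-a^2\sin^2\vartheta)$, $\overline B=\rho^{-2}a\sin^2\vartheta\,[\Delta-(r^2+a^2)]$, $\overline C=\rho^{-2}\sin^2\vartheta\,[(r^2+a^2)^2-\Delta a^2\sin^2\vartheta]$, so that the Kerr metric is $\rho^2(\Delta^{-1}dr^2+d\vartheta^2)+\overline A\,dt^2+2\overline B\,dt\,d\varphi+\overline C\,d\varphi^2$. Let $U$ be an open set in the space of coordinates $(x^1,x^2,y^3,y^4=\varphi)$, and let $r,\vartheta,\mathring g$ be smooth functions of $x=(x^1,x^2)$ with $\mathring g>0$ and $\rho^2(\Delta^{-1}dr^2+d\vartheta^2)=\mathring g\,[(dx^1)^2+(dx^2)^2]$; assume $\Delta>0$, $\sin\vartheta\ne0$, $\overline A\neq 0$ on $U$. Let $y^3=t+\widehat y^3+\varphi\overline B/\overline A$ with $\widehat y^3(x,\varphi)$ smooth and $\partial_\varphi\widehat y^3=-\overline B/\overline A$. The prime data are $\mathring g_1=\mathring g_2=\mathring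 g$, $\mathring h_3=\overline A$, $\mathring h_4=\overline C-\overline B^2/\overline A$, $\mathring n_k=-\partial_k(\widehat y^3+\varphi\overline B/\overline A)$, $\mathring w_k=0$. **Generating data.** Let $\widetilde\Lambda_0\ne0$ be a constant, $\epsilon\in\{1,-1\}$, let $\psi(x)$, $^\eta n(x)$, $\widetilde\eta_3(x,\varphi)$, $^v\Lambda(x,\varphi)$, ${}^\eta\widetilde A(x,\varphi)$ be smooth on $U$, and put $2\Lambda(x)=\partial_{11}^2\psi+\partial_{22}^2\psi$. Assume $\widetilde\Lambda_0\overline A\,\widetilde\eta_3>0$, $\partial_\varphi\widetilde\eta_3\ne0$, $^v\Lambda\ne0$ on $U$. Put $\tilde\Phi=(4\widetilde\Lambda_0\overline A\,\widetilde\eta_3)^{1/2}$ and let $\Xi(x,\varphi)=\int d\varphi\,({}^v\Lambda)\,\partial_\varphi(\tilde\Phi^2)$ be a smooth nowhere zero primitive. Assume the Levi-Civita conditions on the data: $\tilde\Phi$ is a function of $\Xi$, i.e. $\tilde\Phi=H(\Xi)$ on $U$ for some $H:\mathbb R\to\mathbb R$ that is differentiable at every value of $\Xi$ on $U$, and $\partial_i({}^\eta\widetilde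 A)=\partial_i\Xi/\partial_\varphi\Xi$ for $i=1,2$. Define the polarization functions $$\widetilde\eta_1=\widetilde\eta_2=e^{\psi}/\mathring g,\qquad \widetilde\eta_4=\frac{(\partial_\varphi\tilde\Phi)^2}{\Xi\,(\overline C-\overline B^2/\overline A)} .$$ **Theorem.** Consider on $U$ the line element with coefficients $\widetilde\eta_1\mathring g_1=\widetilde\eta_2\mathring g_2=e^\psi$, $\epsilon\,\widetilde\eta_3\mathring h_3$, $\widetilde\eta_4\mathring h_4$ and N-coefficients $n_k=\mathring n_k+\partial_k{}^\eta n$, $w_k=\mathring w_k+\partial_k{}^\eta\widetilde A$, that is $$ds^2=e^{\psi}[(dx^1)^2+(dx^2)^2]+\epsilon\,\widetilde\eta_3\overline A\,\big[dy^3+\big(\partial_k{}^\eta n-\partial_k(\widehat y^3+\varphi\overline B/\overline A)\big)dx^k\big]^2 +\widetilde\eta_4\big(\overline C-\overline B^2/\overline A\big)\big[d\varphi+(\partial_i{}^\eta\widetilde A)dx^i\big]^2 .$$ It is a nonholonomic deformation of the Kerr metric, with the following properties. 1. The Kerr metric is $\mathring g[(dx^1)^2+(dx^2)^2]+\mathring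 h_3(\mathring{\mathbf e}^3)^2+\mathring h_4(d\varphi)^2$ with the nonholonomic covector $\mathring{\mathbf e}^3=dt+(\overline B/\overline A)d\varphi=dy^3+\mathring n_kdx^k+(\overline B/\overline A)d\varphi$. 2. $\widetilde\eta_3=\tilde\Phi^2/(4\widetilde\Lambda_0\overline A)$, and $\widetilde\eta_4$ can be computed from $\widetilde\eta_3$ and $^v\Lambda$: $J=\Xi/(4\widetilde\Lambda_0\overline A)$ is a primitive $\int d\varphi\,({}^v\Lambda)\partial_\varphi\widetilde\eta_3$, and $$\widetilde\eta_4=\operatorname{sgn}(\widetilde\eta_3)\,\overline A\,\big(\partial_\varphi\sqrt{|\widetilde\eta_3|}\big)^2\big/\big[(\overline A\,\overline C-\overline B^2)\,J\big].$$ 3. Let $\mathbf e_i=\partial_i-n_i\partial_{y^3}-w_i\partial_\varphi$, $\mathbf e_3=\partial_{y^3}$, $\mathbf e_4=\partial_\varphi$ be the N-adapted frame, and let $\widehat{\mathbf D}$ be the canonical d-connection: the metric connection that preserves the splitting into $\langle\mathbf e_1,\mathbf e_2\rangle$ and $\langle\mathbf e_3,\mathbf e_4\rangle$, with vanishing purely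 horizontal and purely vertical torsion and with vertical covariant derivatives of horizontal vectors (and horizontal covariant derivatives of vertical vectors) given by the usual canonical coefficients $\widehat C^i_{jc}=\tfrac12g^{ik}\partial_cg_{jk}$, $\widehat L^a_{bk}=\partial_bN^a_k+\tfrac12h^{ac}(\mathbf e_kh_{bc}-h_{dc}\partial_bN^d_k-h_{db}\partial_cN^d_k)$, where $N^3_k=n_k$, $N^4_k=w_k$. The whole torsion of $\widehat{\mathbf D}$ vanishes, so that $\widehat{\mathbf D}$ is the Levi-Civita connection of $ds^2$. 4. $ds^2$ solves the (nonholonomic) Ricci soliton equations with polarized sources: in the N-adapted frame $$\widehat{\mathbf R}_{ij}=-e^{-\psi}\Lambda\,g_{ij},\qquad \widehat{\mathbf R}_{ab}=-\,{}^v\Lambda\,h_{ab},\qquad \widehat{\mathbf R}_{ia}=\widehat{\mathbf R}_{ai}=0 .$$ Consequently, for any function $\kappa$ and constant $\lambda$, the gradient equations $\widehat{\mathbf R}_{\beta\gamma}+\widehat{\mathbf D}_\beta\widehat{\mathbf D}_\gamma\kappa=\lambda\mathbf g_{\beta\gamma}$ hold on $U$ if and only if $\widehat{\mathbf D}_\beta\widehat{\mathbf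 D}_\gamma\kappa=\lambda\mathbf g_{\beta\gamma}-\mathbf\Upsilon_{\beta\gamma}$ there, $\mathbf\Upsilon$ being the right-hand side of the previous display. 5. $\partial/\partial y^3$ is a Killing vector field. -/

import Mathlib

open scoped ContDiff

noncomputable section

namespace KerrSoliton

/-! ### Nonholonomic (2+2)-geometry in one coordinate chart -/

/-- Indices of the conventional 2+2 splitting: `Sum.inl i` are the horizontal indices
(`i = 0, 1` for `x¹, x²`), `Sum.inr a` the vertical ones (`a = 0, 1` for `y³, y⁴ = φ`). -/
abbrev Idx := Fin 2 ⊕ Fin 2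

/-- Points of the coordinate chart, `u = (x¹, x², y³, y⁴)`. -/
abbrev Pt := Idx → ℝ

/-- Partial derivative `∂f/∂u^μ`. -/
def pd (μ : Idx) (f : Pt → ℝ) (u : Pt) : ℝ := fderiv ℝ f u (Pi.single μ 1)

/-- Horizontal partial derivative `∂f/∂xⁱ`. -/
abbrev pdx (i : Fin 2) (f : Pt → ℝ) : Pt → ℝ := pd (Sum.inl i) f

/-- Vertical partial derivative `∂f/∂yᵃ`. -/
abbrev pdy (a : Fin 2) (f : Pt → ℝ) : Pt → ℝ := pd (Sum.inr a) f

/-- `f` does not depend on the coordinate `u^μ` on `U`. -/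
def IndepOf (U : Set Pt) (μ : Idx) (f : Pt → ℝ) : Prop := ∀ u ∈ U, pd μ f u = 0

/-- `f` is a smooth function of the horizontal coordinates `(x¹, x²)` on `U`. -/
structure SmoothX (U : Set Pt) (f : Pt → ℝ) : Prop where
  smooth : ContDiffOn ℝ ∞ f U
  indep3 : IndepOf U (Sum.inr 0) f
  indep4 : IndepOf U (Sum.inr 1) f

/-- `f` is a smooth function of `(x¹, x², φ)` on `U`, where `φ = y⁴`. -/
structure SmoothXPhi (U : Set Pt) (f : Pt → ℝ) : Prop where
  smooth : ContDiffOn ℝ ∞ f U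
  indep3 : IndepOf U (Sum.inr 0) f

/-- A d-metric `g_ij dxⁱ dxʲ + h_ab eᵃ eᵇ`, `eᵃ = dyᵃ + Nᵃ_i dxⁱ`;
`N u a i` is the coefficient `Nᵃ_i` of the N-connection. -/
structure DMetric where
  g : Pt → Matrix (Fin 2) (Fin 2) ℝ
  h : Pt → Matrix (Fin 2) (Fin 2) ℝ
  N : Pt → Matrix (Fin 2) (Fin 2) ℝ

namespace DMetric

variable (D : DMetric)

/-- N-adapted frame `e_i = ∂_i - Nᵇ_i ∂_b`, `e_a = ∂_a`. -/
def frame : Idx → (Pt → ℝ) → Pt → ℝ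
  | Sum.inl i, f => fun u => pdx i f u - ∑ b, D.N u b i * pdy b f u
  | Sum.inr a, f => pdy a f

/-- N-adapted coframe: `coframe u α μ` is the component along `du^μ` of `e^α`, where
`eⁱ = dxⁱ`, `eᵃ = dyᵃ + Nᵃ_i dxⁱ`. -/
def coframe (u : Pt) : Idx → Idx → ℝ
  | Sum.inl i, Sum.inl j => if i = j then 1 else 0
  | Sum.inl _, Sum.inr _ => 0
  | Sum.inr a, Sum.inl i => D.N u a i
  | Sum.inr a, Sum.inr b => if a = b then 1 else 0

/-- Components of the metric with respect to the N-adapted coframe. -/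
def metric : Idx → Idx → Pt → ℝ
  | Sum.inl i, Sum.inl j => fun u => D.g u i j
  | Sum.inr a, Sum.inr b => fun u => D.h u a b
  | _, _ => fun _ => 0

/-- Components of the metric with respect to the coordinate coframe `du^μ`. -/
def coordMetric (μ ν : Idx) (u : Pt) : ℝ :=
  ∑ α, ∑ β, D.metric α β u * D.coframe u α μ * D.coframe u β ν

/-- The quadratic line element `ds²` at `u`, evaluated on `v = (dx¹, dx², dy³, dy⁴)`. -/
def lineElement (u v : Pt) : ℝ := ∑ μ, ∑ ν, D.coordMetric μ ν u * v μ * v ν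

/-- The vector field `X` is a Killing field on `U`: the Lie derivative of the metric along `X`
vanishes there. -/
def IsKilling (U : Set Pt) (X : Pt → Pt) : Prop :=
  ∀ u ∈ U, ∀ μ ν, ∑ τ, (X u τ * pd τ (D.coordMetric μ ν) u
    + D.coordMetric τ ν u * pd μ (fun p => X p τ) u
    + D.coordMetric μ τ u * pd ν (fun p => X p τ) u) = 0

/-- Nonholonomy coefficients `W^γ_αβ`, given by `[e_α, e_β] = W^γ_αβ e_γ`. -/
def anholonomy : Idx → Idx → Idx → Pt → ℝ
  | Sum.inr a, Sum.inl i, Sum.inl j => fun u =>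
      D.frame (Sum.inl j) (fun p => D.N p a i) u - D.frame (Sum.inl i) (fun p => D.N p a j) u
  | Sum.inr b, Sum.inl i, Sum.inr a => pdy a (fun p => D.N p b i)
  | Sum.inr b, Sum.inr a, Sum.inl i => fun u => -pdy a (fun p => D.N p b i) u
  | _, _, _ => fun _ => 0

/-- N-adapted coefficients of the canonical d-connection, `conn γ β α = Γ^γ_βα` with
`D_{e_α} e_β = Γ^γ_βα e_γ`: in order, the blocks `Lⁱ_jk`, `Lᵃ_bk`, `Cⁱ_jc`, `Cᵃ_bc`. -/
def conn : Idx → Idx → Idx → Pt → ℝ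
  | Sum.inl i, Sum.inl j, Sum.inl k => fun u => 1 / 2 * ∑ s, (D.g u)⁻¹ i s *
      (D.frame (Sum.inl k) (fun p => D.g p j s) u + D.frame (Sum.inl j) (fun p => D.g p k s) u
        - D.frame (Sum.inl s) (fun p => D.g p j k) u)
  | Sum.inr a, Sum.inr b, Sum.inl k => fun u => pdy b (fun p => D.N p a k) u
      + 1 / 2 * ∑ c, (D.h u)⁻¹ a c * (D.frame (Sum.inl k) (fun p => D.h p b c) u
        - ∑ d, D.h u d c * pdy b (fun p => D.N p d k) u
        - ∑ d, D.h u d b * pdy c (fun p => D.N p d k) u)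
  | Sum.inl i, Sum.inl j, Sum.inr c => fun u =>
      1 / 2 * ∑ k, (D.g u)⁻¹ i k * pdy c (fun p => D.g p j k) u
  | Sum.inr a, Sum.inr b, Sum.inr c => fun u => 1 / 2 * ∑ d, (D.h u)⁻¹ a d *
      (pdy c (fun p => D.h p b d) u + pdy b (fun p => D.h p c d) u - pdy d (fun p => D.h p b c) u)
  | _, _, _ => fun _ => 0

/-- Torsion of the canonical d-connection,
`T(e_α, e_β) = D_{e_α} e_β - D_{e_β} e_α - [e_α, e_β] = T^γ_αβ e_γ`. -/
def torsion (γ α β : Idx) (u : Pt) : ℝ :=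
  D.conn γ β α u - D.conn γ α β u - D.anholonomy γ α β u

/-- The covariant derivative `(D_{e_α} g)(e_β, e_γ)` of the metric. -/
def nonmetricity (α β γ : Idx) (u : Pt) : ℝ :=
  D.frame α (D.metric β γ) u - ∑ τ, D.conn τ β α u * D.metric τ γ u
    - ∑ τ, D.conn τ γ α u * D.metric β τ u

/-- The canonical d-connection is metric and torsion-free on `U`, i.e. it is the Levi-Civita
connection of the metric there. -/
def IsLCConfiguration (U : Set Pt) : Prop :=
  ∀ u ∈ U, ∀ α β γ, D.nonmetricity α β γ u = 0 ∧ D.torsion α β γ u = 0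

/-- Curvature of the canonical d-connection, `R(e_γ, e_δ) e_β = R^α_βγδ e_α`. -/
def curvature (α β γ δ : Idx) (u : Pt) : ℝ :=
  D.frame γ (D.conn α β δ) u - D.frame δ (D.conn α β γ) u
    + ∑ τ, (D.conn τ β δ u * D.conn α τ γ u - D.conn τ β γ u * D.conn α τ δ u
      - D.anholonomy τ γ δ u * D.conn α β τ u)

/-- Ricci d-tensor: the trace of `X ↦ R(X, e_γ) e_β`. -/
def ricci (β γ : Idx) (u : Pt) : ℝ := ∑ α, D.curvature α β α γ u

/-- `(D_β D_γ κ)` for the canonical d-connection. -/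
def hessian (κ : Pt → ℝ) (β γ : Idx) (u : Pt) : ℝ :=
  D.frame β (D.frame γ κ) u - ∑ τ, D.conn τ γ β u * D.frame τ κ u

/-- The symmetric d-tensor `(ʰΥ g_ij, ᵛΥ h_ab)` with vanishing mixed components. -/
def source (hΥ vΥ : Pt → ℝ) : Idx → Idx → Pt → ℝ
  | Sum.inl i, Sum.inl j => fun u => hΥ u * D.g u i j
  | Sum.inr a, Sum.inr b => fun u => vΥ u * D.h u a b
  | _, _ => fun _ => 0

/-- The nonholonomic Ricci soliton equations with polarised sources on `U`:
`R_ij = ʰΥ g_ij`, `R_ab = ᵛΥ h_ab`, `R_ia = R_ai = 0`. -/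
def SolvesWithSource (U : Set Pt) (hΥ vΥ : Pt → ℝ) : Prop :=
  ∀ u ∈ U, ∀ β γ, D.ricci β γ u = D.source hΥ vΥ β γ u

/-- The gradient nonholonomic Ricci soliton equations `R_βγ + D_β D_γ κ = lam g_βγ` on `U`. -/
def IsGradientSoliton (U : Set Pt) (κ : Pt → ℝ) (lam : ℝ) : Prop :=
  ∀ u ∈ U, ∀ β γ, D.ricci β γ u + D.hessian κ β γ u = lam * D.metric β γ u

end DMetric

/-! ### The prime Kerr data -/

/-- `Δ = r² - 2 m₀ r + a²`. -/
def kerrDelta (m₀ a r : ℝ) : ℝ := r ^ 2 - 2 * m₀ * r + a ^ 2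

/-- `r² + a² cos² ϑ`. -/
def kerrSigma (a r ϑ : ℝ) : ℝ := r ^ 2 + a ^ 2 * Real.cos ϑ ^ 2

/-- The coefficient of `dt²`. -/
def kerrA (m₀ a r ϑ : ℝ) : ℝ :=
  -(kerrDelta m₀ a r - a ^ 2 * Real.sin ϑ ^ 2) / kerrSigma a r ϑ

/-- Half the coefficient of `dt dφ`. -/
def kerrB (m₀ a r ϑ : ℝ) : ℝ :=
  a * Real.sin ϑ ^ 2 * (kerrDelta m₀ a r - (r ^ 2 + a ^ 2)) / kerrSigma a r ϑ

/-- The coefficient of `dφ²`. -/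
def kerrC (m₀ a r ϑ : ℝ) : ℝ :=
  Real.sin ϑ ^ 2 * ((r ^ 2 + a ^ 2) ^ 2 - kerrDelta m₀ a r * a ^ 2 * Real.sin ϑ ^ 2)
    / kerrSigma a r ϑ

/-- The Kerr line element in Boyer-Lindquist coordinates at `(r, ϑ)`, evaluated on
`(dt, dr, dϑ, dφ)`. -/
def kerrLineElement (m₀ a r ϑ dt dr dϑ dφ : ℝ) : ℝ :=
  kerrSigma a r ϑ * (dr ^ 2 / kerrDelta m₀ a r + dϑ ^ 2)
    + kerrA m₀ a r ϑ * dt ^ 2 + 2 * kerrB m₀ a r ϑ * dt * dφ + kerrC m₀ a r ϑ * dφ ^ 2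

/-- Data of the coordinates `(x¹, x², y³, φ)` for the Kerr metric: mass and rotation parameters,
the Boyer-Lindquist functions `r(x¹,x²)`, `ϑ(x¹,x²)`, the prime coefficient
`gPrime = g̊₁ = g̊₂`, and the function `yHat(x¹,x²,φ)` with `y³ = t + yHat + φ B/A`. -/
structure KerrChart where
  m₀ : ℝ
  a : ℝ
  r : Pt → ℝ
  ϑ : Pt → ℝ
  gPrime : Pt → ℝ
  yHat : Pt → ℝ

namespace KerrChart

variable (K : KerrChart)

/-- `Ā`, the prime coefficient `h̊₃`. -/
def A (u : Pt) : ℝ := kerrA K.m₀ K.a (K.r u) (K.ϑ u)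

def B (u : Pt) : ℝ := kerrB K.m₀ K.a (K.r u) (K.ϑ u)

def C (u : Pt) : ℝ := kerrC K.m₀ K.a (K.r u) (K.ϑ u)

/-- The prime coefficient `h̊₄ = C̄ - B̄²/Ā`. -/
def h4Prime (u : Pt) : ℝ := K.C u - K.B u ^ 2 / K.A u

/-- `yHat + φ B̄/Ā`, so that `y³ = t + shift`. -/
def shift (u : Pt) : ℝ := K.yHat u + u (Sum.inr 1) * (K.B u / K.A u)

/-- The prime N-coefficients `n̊_k = -∂_k (yHat + φ B̄/Ā)`. -/
def nPrime (k : Fin 2) (u : Pt) : ℝ := -pdx k K.shift u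

/-- The prime N-coefficients `ẘ_k = 0`. -/
def wPrime (_ : KerrChart) (_ : Fin 2) (_ : Pt) : ℝ := 0

/-- The Boyer-Lindquist time `t = y³ - yHat - φ B̄/Ā` as a function on the chart. -/
def t (u : Pt) : ℝ := u (Sum.inr 0) - K.shift u

/-- The chart is admissible on `U`: `x¹, x²` are isothermal coordinates for the `(r, ϑ)`-part,
`(kerrSigma) (dr²/Δ + dϑ²) = gPrime ((dx¹)² + (dx²)²)`, in a region where `Δ > 0`, off the axis
and off the surface `Ā = 0`, and `∂_φ yHat = -B̄/Ā`. -/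
structure Admissible (U : Set Pt) : Prop where
  smooth_r : SmoothX U K.r
  smooth_theta : SmoothX U K.ϑ
  smooth_gPrime : SmoothX U K.gPrime
  smooth_yHat : SmoothXPhi U K.yHat
  delta_pos : ∀ u ∈ U, 0 < kerrDelta K.m₀ K.a (K.r u)
  sin_ne : ∀ u ∈ U, Real.sin (K.ϑ u) ≠ 0
  A_ne : ∀ u ∈ U, K.A u ≠ 0
  gPrime_pos : ∀ u ∈ U, 0 < K.gPrime u
  isothermal : ∀ u ∈ U, ∀ i j : Fin 2, kerrSigma K.a (K.r u) (K.ϑ u) *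
    (pdx i K.r u * pdx j K.r u / kerrDelta K.m₀ K.a (K.r u) + pdx i K.ϑ u * pdx j K.ϑ u)
      = if i = j then K.gPrime u else 0
  yHat_phi : ∀ u ∈ U, pdy 1 K.yHat u = -(K.B u / K.A u)

end KerrChart

/-! ### Generating data and the target line element -/

/-- Generating data: `ψ(x)`, its source `Lam(x)`, the polarization `eta3 = η̃₃(x,φ)`,
the N-connection potentials `A = ^ηÃ(x,φ)` and `n = ^ηn(x)`, the source `vLam = ᵛΛ(x,φ)`, the
constant `Lam0 = Λ̃₀`, a chosen primitive `Xi = Ξ(x,φ)`, and a sign `ε`. -/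
structure GenData where
  ψ : Pt → ℝ
  Lam : Pt → ℝ
  eta3 : Pt → ℝ
  A : Pt → ℝ
  n : Pt → ℝ
  vLam : Pt → ℝ
  Xi : Pt → ℝ
  Lam0 : ℝ
  ε : ℝ

namespace GenData

variable (P : GenData) (K : KerrChart)

/-- `Φ̃`, with `Φ̃² = 4 Λ̃₀ Ā η̃₃`. -/
def Phi (u : Pt) : ℝ := Real.sqrt (4 * P.Lam0 * K.A u * P.eta3 u)

/-- `η̃₁ = η̃₂`, with `η̃₁ g̊₁ = exp ψ`. -/
def eta1 (u : Pt) : ℝ := Real.exp (P.ψ u) / K.gPrime u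

/-- `η̃₄ = (∂_φ Φ̃)² / (Ξ (C̄ - B̄²/Ā))`. -/
def eta4 (u : Pt) : ℝ := pdy 1 (P.Phi K) u ^ 2 / (P.Xi u * K.h4Prime u)

/-- The target d-metric: the coefficients of the prime data multiplied by the polarizations
(with the sign `ε` in front of the `y³` part), and the deformed N-coefficients
`n_k = n̊_k + ∂_k n`, `w_k = ẘ_k + ∂_k A`. -/
def target : DMetric where
  g u := Matrix.diagonal fun _ => P.eta1 K u * K.gPrime u
  h u := Matrix.diagonal ![P.ε * (P.eta3 u * K.A u), P.eta4 K u * K.h4Prime u]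
  N u := Matrix.of ![fun k => K.nPrime k u + pdx k P.n u, fun k => K.wPrime k u + pdx k P.A u]

/-- Conditions on the generating data on `U`. -/
structure Admissible (U : Set Pt) : Prop where
  smooth_psi : SmoothX U P.ψ
  smooth_eta3 : SmoothXPhi U P.eta3
  smooth_A : SmoothXPhi U P.A
  smooth_n : SmoothX U P.n
  smooth_vLam : SmoothXPhi U P.vLam
  smooth_Xi : SmoothXPhi U P.Xi
  sign : P.ε = 1 ∨ P.ε = -1
  Lam0_ne : P.Lam0 ≠ 0
  vLam_ne : ∀ u ∈ U, P.vLam u ≠ 0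
  Xi_ne : ∀ u ∈ U, P.Xi u ≠ 0
  Phi_sq_pos : ∀ u ∈ U, 0 < 4 * P.Lam0 * K.A u * P.eta3 u
  eta3_phi_ne : ∀ u ∈ U, pdy 1 P.eta3 u ≠ 0
  /-- `∂₁₁ψ + ∂₂₂ψ = 2 Λ(x)`. -/
  poisson : ∀ u ∈ U, pdx 0 (pdx 0 P.ψ) u + pdx 1 (pdx 1 P.ψ) u = 2 * P.Lam u
  /-- `Ξ = ∫ dφ ᵛΛ ∂_φ(Φ̃²)`. -/
  Xi_primitive : ∀ u ∈ U,
    pdy 1 P.Xi u = P.vLam u * pdy 1 (fun p => P.Phi K p ^ 2) u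
  /-- `Φ̃` and `Ξ` are functionally related. -/
  functional : ∃ H : ℝ → ℝ, ∀ u ∈ U, DifferentiableAt ℝ H (P.Xi u) ∧ P.Phi K u = H (P.Xi u)
  /-- `∂_i A = ∂_i Ξ / ∂_φ Ξ`. -/
  potential : ∀ u ∈ U, ∀ i, pdx i P.A u = pdx i P.Xi u / pdy 1 P.Xi u

end GenData

end KerrSoliton

end

open KerrSoliton

/-! The vector fields e_k = ∂_k − w_k ∂_φ on functions of (x, φ) drive everything. Since w_k =
∂_kΞ/∂_φΞ, they annihilate Ξ, hence also Φ̃ = H(Ξ) and h₃ = (ε/4Λ̃₀) Φ̃². The commutator [e_k, ∂_φ]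
= ∂_φw_k ∂_φ gives e_k(∂_φΦ̃) = ∂_φw_k ∂_φΦ̃, so h₄ = (∂_φΦ̃)²/Ξ satisfies e_k h₄ = 2 ∂_φw_k h₄.
Moreover [e_i, e_j] is a multiple of ∂_φ that annihilates Ξ, and ∂_φΞ ≠ 0, so it vanishes. The
N-coefficients n_k are the gradient of a function of x alone, because ∂_φŷ³ cancels the φ-dependence
of φB̄/Ā. These facts are collected in `IsLCMetric` and proved for the target in
`isLCMetric_target`.

For every such metric the canonical coefficients collapse to `lcGamma` (`conn_eq`), which are metric
and torsion-free. The Ricci tensor splits: the horizontal block is that of a conformally flat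
surface, −½(∂₁₁ψ + ∂₂₂ψ) δ_ij; the vertical block is that of the surface h₃dy² + h₄dφ²; the mixed
blocks cancel by the commutator relation. With the given h₃ and h₄, the vertical factor reduces to
−∂_φΞ/(2Φ̃∂_φΦ̃) = −ᵛΛ, which is how Ξ was chosen (`solvesWithSource`).

All identities hold only on the open set U; openness is what allows them to be differentiated. -/

namespace KerrSoliton

/-! ### Calculus of coordinate partial derivatives. -/

section Calculus

variable {U : Set Pt} {u : Pt} {f g : Pt → ℝ} (μ ν : Idx)

theorem pd_congr (hU : IsOpen U) (h : ∀ p ∈ U, f p = g p) (hu : u ∈ U) :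
    pd μ f u = pd μ g u := by
  unfold pd
  rw [Filter.EventuallyEq.fderiv_eq (Filter.eventually_of_mem (hU.mem_nhds hu) h)]

theorem pd_const (c : ℝ) : pd μ (fun _ => c) u = 0 := by simp [pd]

theorem pd_add (hf : DifferentiableAt ℝ f u) (hg : DifferentiableAt ℝ g u) :
    pd μ (fun p => f p + g p) u = pd μ f u + pd μ g u := by
  simp [pd, fderiv_fun_add hf hg]

theorem pd_sub (hf : DifferentiableAt ℝ f u) (hg : DifferentiableAt ℝ g u) :
    pd μ (fun p => f p - g p) u = pd μ f u - pd μ g u := by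
  simp [pd, fderiv_fun_sub hf hg]

theorem pd_neg : pd μ (fun p => -f p) u = -pd μ f u := by
  simp [pd, fderiv_fun_neg]

theorem pd_mul (hf : DifferentiableAt ℝ f u) (hg : DifferentiableAt ℝ g u) :
    pd μ (fun p => f p * g p) u = pd μ f u * g u + f u * pd μ g u := by
  simp [pd, fderiv_fun_mul hf hg]; ring

theorem pd_const_mul (c : ℝ) (hf : DifferentiableAt ℝ f u) :
    pd μ (fun p => c * f p) u = c * pd μ f u := by
  rw [pd_mul μ (differentiableAt_const c) hf, pd_const]; ring

theorem pd_comp {F : ℝ → ℝ} (hF : DifferentiableAt ℝ F (f u)) (hf : DifferentiableAt ℝ f u) :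
    pd μ (fun p => F (f p)) u = deriv F (f u) * pd μ f u := by
  have h := (hF.hasDerivAt.comp_hasFDerivAt u hf.hasFDerivAt).fderiv
  simp only [Function.comp_def] at h
  simp [pd, h]

theorem pd_div (hf : DifferentiableAt ℝ f u) (hg : DifferentiableAt ℝ g u) (h0 : g u ≠ 0) :
    pd μ (fun p => f p / g p) u = (pd μ f u * g u - f u * pd μ g u) / g u ^ 2 := by
  have h1 : pd μ (fun p => (g p)⁻¹) u = -(g u ^ 2)⁻¹ * pd μ g u := by
    rw [pd_comp μ (F := fun x => x⁻¹) (differentiableAt_inv h0) hg, deriv_inv]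
  simp only [div_eq_mul_inv]
  rw [pd_mul μ (g := fun p => (g p)⁻¹) hf (hg.inv h0), h1]
  field_simp
  ring

theorem pd_sq (hf : DifferentiableAt ℝ f u) :
    pd μ (fun p => f p ^ 2) u = 2 * f u * pd μ f u := by
  simp only [sq]
  rw [pd_mul μ hf hf]; ring

theorem pd_exp (hf : DifferentiableAt ℝ f u) :
    pd μ (fun p => Real.exp (f p)) u = Real.exp (f u) * pd μ f u := by
  rw [pd_comp μ Real.differentiableAt_exp hf, Real.deriv_exp]

theorem pd_coord : pd μ (fun p => p ν) u = if μ = ν then 1 else 0 := by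
  have h : HasFDerivAt (fun p : Pt => p ν) (ContinuousLinearMap.proj (R := ℝ) ν) u :=
    (ContinuousLinearMap.proj (R := ℝ) (φ := fun _ : Idx => ℝ) ν).hasFDerivAt
  simp [pd, h.fderiv, Pi.single_apply, eq_comm]

theorem differentiableAt_coord : DifferentiableAt ℝ (fun p : Pt => p ν) u :=
  (ContinuousLinearMap.proj (R := ℝ) (φ := fun _ : Idx => ℝ) ν).differentiableAt

theorem fderiv_eq_sum_pd (v : Pt) : fderiv ℝ f u v = ∑ μ, pd μ f u * v μ := by
  conv_lhs => rw [pi_eq_sum_univ' v, map_sum]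
  refine Finset.sum_congr rfl fun μ _ => ?_
  simp [pd, mul_comm]

theorem smooth_pd (hU : IsOpen U) (hf : ContDiffOn ℝ ∞ f U) : ContDiffOn ℝ ∞ (pd μ f) U :=
  (hf.fderiv_of_isOpen hU (m := ∞) (by simp)).clm_apply contDiffOn_const

theorem smooth_differentiableAt (hU : IsOpen U) (hf : ContDiffOn ℝ ∞ f U) (hu : u ∈ U) :
    DifferentiableAt ℝ f u :=
  (hf.contDiffAt (hU.mem_nhds hu)).differentiableAt (by simp)

/-- Iterated partials become values of the second Fréchet derivative, where symmetry is available.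
-/
theorem pd_pd_eq (hU : IsOpen U) (hf : ContDiffOn ℝ ∞ f U) (hu : u ∈ U) :
    pd μ (pd ν f) u = fderiv ℝ (fderiv ℝ f) u (Pi.single μ 1) (Pi.single ν 1) := by
  have hd : DifferentiableAt ℝ (fderiv ℝ f) u :=
    ((hf.fderiv_of_isOpen hU (m := ∞) (by simp)).contDiffAt (hU.mem_nhds hu)).differentiableAt
      (by simp)
  have := (hd.hasFDerivAt.clm_apply (hasFDerivAt_const (Pi.single ν (1 : ℝ)) u)).fderiv
  unfold pd
  rw [this]
  simp

theorem pd_comm (hU : IsOpen U) (hf : ContDiffOn ℝ ∞ f U) (hu : u ∈ U) :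
    pd μ (pd ν f) u = pd ν (pd μ f) u := by
  rw [pd_pd_eq μ ν hU hf hu, pd_pd_eq ν μ hU hf hu]
  exact ((hf.contDiffAt (hU.mem_nhds hu)).isSymmSndFDerivAt
    (by simpa using WithTop.coe_le_coe.mpr (le_top (a := (2 : ℕ∞))))) _ _

theorem IndepOf.pd (hU : IsOpen U) (hf : ContDiffOn ℝ ∞ f U) (h : IndepOf U ν f) :
    IndepOf U ν (pd μ f) := fun u hu => by
  rw [pd_comm ν μ hU hf hu, pd_congr μ hU h hu, pd_const]

end Calculus

/-! ### Metrics of Levi-Civita type: connection and torsion. -/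

/-- The d-metric `e^ψ ((dx¹)² + (dx²)²) + h₃ (dy³ + n_k dxᵏ)² + h₄ (dφ + w_k dxᵏ)²` on `U`, with
coefficients independent of `y³`, subject to the conditions which make the torsion of the
canonical d-connection vanish. -/
structure IsLCMetric (U : Set Pt) (D : DMetric) (ψ h3 h4 : Pt → ℝ) (n w : Fin 2 → Pt → ℝ) :
    Prop where
  isOpen : IsOpen U
  g_eq : ∀ u ∈ U, D.g u = Matrix.diagonal fun _ => Real.exp (ψ u)
  h_eq : ∀ u ∈ U, D.h u = Matrix.diagonal ![h3 u, h4 u]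
  N_zero : ∀ u ∈ U, ∀ k, D.N u 0 k = n k u
  N_one : ∀ u ∈ U, ∀ k, D.N u 1 k = w k u
  smooth_psi : SmoothX U ψ
  smooth_h3 : SmoothXPhi U h3
  smooth_h4 : SmoothXPhi U h4
  smooth_n : ∀ k, SmoothX U (n k)
  smooth_w : ∀ k, SmoothXPhi U (w k)
  h3_ne : ∀ u ∈ U, h3 u ≠ 0
  h4_ne : ∀ u ∈ U, h4 u ≠ 0
  pdx_h3 : ∀ u ∈ U, ∀ k, pdx k h3 u = w k u * pdy 1 h3 u
  pdx_h4 : ∀ u ∈ U, ∀ k, pdx k h4 u = w k u * pdy 1 h4 u + 2 * pdy 1 (w k) u * h4 u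
  closed_n : ∀ u ∈ U, ∀ i j, pdx i (n j) u = pdx j (n i) u
  closed_w : ∀ u ∈ U, ∀ i j, pdx i (w j) u - w i u * pdy 1 (w j) u
    = pdx j (w i) u - w j u * pdy 1 (w i) u

/-- The horizontal Christoffel symbols of the conformally flat metric `e^ψ ((dx¹)² + (dx²)²)`. -/
noncomputable def conformalGamma (ψ : Pt → ℝ) (i j k : Fin 2) (u : Pt) : ℝ :=
  1 / 2 * ((if i = j then 1 else 0) * pdx k ψ u + (if i = k then 1 else 0) * pdx j ψ u
    - (if j = k then 1 else 0) * pdx i ψ u)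

/-- Half the logarithmic derivative `∂_φ h / (2 h)`. -/
noncomputable def halfLog (h : Pt → ℝ) (u : Pt) : ℝ := pdy 1 h u / (2 * h u)

/-- The nonvanishing connection coefficients of an `IsLCMetric`. -/
noncomputable def lcGamma (ψ h3 h4 : Pt → ℝ) (w : Fin 2 → Pt → ℝ) : Idx → Idx → Idx → Pt → ℝ
  | Sum.inl i, Sum.inl j, Sum.inl k => conformalGamma ψ i j k
  | Sum.inr a, Sum.inr b, Sum.inl k =>
      ![![fun _ => 0, fun _ => 0], ![fun _ => 0, pdy 1 (w k)]] a b
  | Sum.inr a, Sum.inr b, Sum.inr c =>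
      ![![![fun _ => 0, halfLog h3], ![halfLog h3, fun _ => 0]],
        ![![fun u => -pdy 1 h3 u / (2 * h4 u), fun _ => 0], ![fun _ => 0, halfLog h4]]] a b c
  | _, _, _ => fun _ => 0

theorem DMetric.frame_inl (D : DMetric) (k : Fin 2) (f : Pt → ℝ) (u : Pt) :
    D.frame (Sum.inl k) f u = pdx k f u - (D.N u 0 k * pdy 0 f u + D.N u 1 k * pdy 1 f u) := by
  simp [DMetric.frame, Fin.sum_univ_two]

theorem DMetric.frame_inr (D : DMetric) (a : Fin 2) (f : Pt → ℝ) (u : Pt) :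
    D.frame (Sum.inr a) f u = pdy a f u := rfl

theorem DMetric.frame_congr (D : DMetric) {U : Set Pt} (hU : IsOpen U) {f g : Pt → ℝ}
    (h : ∀ p ∈ U, f p = g p) {u : Pt} (hu : u ∈ U) (α : Idx) : D.frame α f u = D.frame α g u := by
  cases α <;> simp only [DMetric.frame_inl, DMetric.frame_inr, pd_congr _ hU h hu]

theorem DMetric.frame_zero (D : DMetric) (α : Idx) (u : Pt) :
    D.frame α (fun _ => 0) u = 0 := by
  cases α <;> simp [DMetric.frame_inl, DMetric.frame_inr, pd_const]

theorem inv_diagonal_of_ne {d : Fin 2 → ℝ} (h : ∀ i, d i ≠ 0) :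
    (Matrix.diagonal d)⁻¹ = Matrix.diagonal fun i => (d i)⁻¹ := by
  refine Matrix.inv_eq_right_inv ?_
  rw [Matrix.diagonal_mul_diagonal]
  simp [h]

namespace IsLCMetric

variable {U : Set Pt} {D : DMetric} {ψ h3 h4 : Pt → ℝ} {n w : Fin 2 → Pt → ℝ} {u : Pt}

theorem frame_g (H : IsLCMetric U D ψ h3 h4 n w) (hu : u ∈ U) (k i j : Fin 2) :
    D.frame (Sum.inl k) (fun p => D.g p i j) u
      = if i = j then Real.exp (ψ u) * pdx k ψ u else 0 := by
  have hd := smooth_differentiableAt H.isOpen H.smooth_psi.smooth hu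
  rw [D.frame_congr H.isOpen (g := fun p => if i = j then Real.exp (ψ p) else 0)
    (fun p hp => by rw [H.g_eq p hp, Matrix.diagonal_apply]) hu]
  split_ifs
  · simp only [D.frame_inl, pd_exp _ hd, H.smooth_psi.indep3 u hu, H.smooth_psi.indep4 u hu]
    ring
  · exact D.frame_zero _ _

theorem pdy_g (H : IsLCMetric U D ψ h3 h4 n w) (hu : u ∈ U) (c i j : Fin 2) :
    pdy c (fun p => D.g p i j) u = 0 := by
  have hd := smooth_differentiableAt H.isOpen H.smooth_psi.smooth hu
  refine (pd_congr _ H.isOpen (g := fun p => if i = j then Real.exp (ψ p) else 0)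
    (fun p hp => by rw [H.g_eq p hp, Matrix.diagonal_apply]) hu).trans ?_
  split_ifs
  · rw [pd_exp _ hd]
    fin_cases c
    · simp [H.smooth_psi.indep3 u hu]
    · simp [H.smooth_psi.indep4 u hu]
  · exact pd_const _ _

/-- Here the two transport conditions enter: in adapted form they say e_k h₃ = 0 and e_k h₄ = 2
∂_φw_k h₄. -/
theorem frame_h (H : IsLCMetric U D ψ h3 h4 n w) (hu : u ∈ U) (k a b : Fin 2) :
    D.frame (Sum.inl k) (fun p => D.h p a b) u
      = !![0, 0; 0, 2 * pdy 1 (w k) u * h4 u] a b := by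
  rw [D.frame_congr H.isOpen (g := ![![h3, fun _ => 0], ![fun _ => 0, h4]] a b)
    (fun p hp => by rw [H.h_eq p hp]; fin_cases a <;> fin_cases b <;> simp) hu]
  fin_cases a <;> fin_cases b <;>
    simp [D.frame_zero, D.frame_inl, H.N_zero u hu, H.N_one u hu, H.smooth_h3.indep3 u hu,
      H.smooth_h4.indep3 u hu, H.pdx_h3 u hu, H.pdx_h4 u hu]

theorem pdy_h (H : IsLCMetric U D ψ h3 h4 n w) (hu : u ∈ U) (c a b : Fin 2) :
    pdy c (fun p => D.h p a b) u
      = ![!![0, 0; 0, 0], !![pdy 1 h3 u, 0; 0, pdy 1 h4 u]] c a b := by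
  refine (pd_congr _ H.isOpen (g := ![![h3, fun _ => 0], ![fun _ => 0, h4]] a b)
    (fun p hp => by rw [H.h_eq p hp]; fin_cases a <;> fin_cases b <;> simp) hu).trans ?_
  fin_cases a <;> fin_cases b <;> fin_cases c <;>
    simp [pd_const, H.smooth_h3.indep3 u hu, H.smooth_h4.indep3 u hu]

theorem pdy_N (H : IsLCMetric U D ψ h3 h4 n w) (hu : u ∈ U) (c a k : Fin 2) :
    pdy c (fun p => D.N p a k) u = !![0, 0; 0, pdy 1 (w k) u] a c := by
  refine (pd_congr _ H.isOpen (g := ![n k, w k] a)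
    (fun p hp => by fin_cases a <;> simp [H.N_zero p hp, H.N_one p hp]) hu).trans ?_
  fin_cases a <;> fin_cases c <;>
    simp [(H.smooth_n k).indep3 u hu, (H.smooth_n k).indep4 u hu, (H.smooth_w k).indep3 u hu]

theorem g_inv (H : IsLCMetric U D ψ h3 h4 n w) (hu : u ∈ U) :
    (D.g u)⁻¹ = Matrix.diagonal fun _ => (Real.exp (ψ u))⁻¹ := by
  rw [H.g_eq u hu, inv_diagonal_of_ne fun _ => (Real.exp_pos _).ne']

theorem h_inv (H : IsLCMetric U D ψ h3 h4 n w) (hu : u ∈ U) :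
    (D.h u)⁻¹ = Matrix.diagonal ![(h3 u)⁻¹, (h4 u)⁻¹] := by
  rw [H.h_eq u hu, inv_diagonal_of_ne]
  · congr 1; ext i; fin_cases i <;> rfl
  · intro i; fin_cases i
    exacts [H.h3_ne u hu, H.h4_ne u hu]

/-- The decisive block is Lᵃ_bk: the transport conditions cancel its metric correction, leaving
Lᵃ_bk = ∂_bNᵃ_k, which is what zero mixed torsion requires. -/
theorem conn_eq (H : IsLCMetric U D ψ h3 h4 n w) (hu : u ∈ U) (γ β α : Idx) :
    D.conn γ β α u = lcGamma ψ h3 h4 w γ β α u := by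
  have h3_ne := H.h3_ne u hu
  have h4_ne := H.h4_ne u hu
  have hexp := (Real.exp_pos (ψ u)).ne'
  rcases γ with i | a <;> rcases β with j | b <;> rcases α with k | c
  · simp only [DMetric.conn, lcGamma, conformalGamma, H.frame_g hu, H.g_inv hu,
      Matrix.diagonal_apply, Fin.sum_univ_two]
    fin_cases i <;> fin_cases j <;> fin_cases k <;> simp [hexp]
  · simp [DMetric.conn, lcGamma, H.pdy_g hu]
  · rfl
  · rfl
  · rfl
  · rfl
  · simp only [DMetric.conn, lcGamma, H.frame_h hu, H.h_inv hu, H.pdy_N hu, Fin.sum_univ_two]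
    simp only [H.h_eq u hu]
    fin_cases a <;> fin_cases b <;> simp
    -- What remains is the (φ, φ) entry, where 2 ∂_φw h₄ − h₄ ∂_φw − h₄ ∂_φw = 0.
    exact Or.inr (by ring)
  · simp only [DMetric.conn, lcGamma, H.pdy_h hu, H.h_inv hu, Fin.sum_univ_two]
    fin_cases a <;> fin_cases b <;> fin_cases c <;> simp [halfLog] <;> field_simp

/-- This is the curvature of the N-connection. For n it is an ordinary curl, as n depends on x only;
for w it is the twisted curl of `closed_w`. -/
theorem anholonomy_inl_inl (H : IsLCMetric U D ψ h3 h4 n w) (hu : u ∈ U) (γ : Idx)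
    (i j : Fin 2) : D.anholonomy γ (Sum.inl i) (Sum.inl j) u = 0 := by
  rcases γ with k | a
  · rfl
  · have hc : ∀ p ∈ U, ∀ k, D.N p a k = ![n k, w k] a p := fun p hp k => by
      fin_cases a <;> simp [H.N_zero p hp, H.N_one p hp]
    simp only [DMetric.anholonomy]
    rw [D.frame_congr H.isOpen (fun p hp => hc p hp i) hu,
      D.frame_congr H.isOpen (fun p hp => hc p hp j) hu]
    simp only [D.frame_inl, H.N_zero u hu, H.N_one u hu]
    fin_cases a
    · simp [(H.smooth_n _).indep3 u hu, (H.smooth_n _).indep4 u hu, H.closed_n u hu i j]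
    · have := H.closed_w u hu i j
      simp [(H.smooth_w _).indep3 u hu]
      linarith

theorem nonmetricity_eq_zero (H : IsLCMetric U D ψ h3 h4 n w) (hu : u ∈ U) (α β γ : Idx) :
    D.nonmetricity α β γ u = 0 := by
  have h3_ne := H.h3_ne u hu
  have h4_ne := H.h4_ne u hu
  simp only [DMetric.nonmetricity, H.conn_eq hu, Fintype.sum_sum_type, Fin.sum_univ_two]
  rcases α with k | c <;> rcases β with i | a <;> rcases γ with j | b <;>
    simp only [lcGamma, DMetric.metric, D.frame_zero, H.g_eq u hu, H.h_eq u hu, D.frame_inr,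
      H.frame_g hu, H.frame_h hu, H.pdy_g hu, H.pdy_h hu, conformalGamma,
      Matrix.diagonal_apply]
  · fin_cases i <;> fin_cases j <;> fin_cases k <;> simp <;> ring
  · simp
  · simp
  · fin_cases a <;> fin_cases b <;> simp <;> ring
  · simp
  · simp
  · simp
  · fin_cases a <;> fin_cases b <;> fin_cases c <;> simp [halfLog] <;> field_simp <;> ring

/-- The horizontal and vertical blocks are symmetric in their lower indices; in the mixed block
∂_φw_k cancels against the nonholonomy coefficient. -/
theorem torsion_eq_zero (H : IsLCMetric U D ψ h3 h4 n w) (hu : u ∈ U) (α β γ : Idx) :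
    D.torsion α β γ u = 0 := by
  simp only [DMetric.torsion, H.conn_eq hu]
  rcases β with i | a <;> rcases γ with j | b
  · rw [H.anholonomy_inl_inl hu]
    rcases α with k | c
    · simp only [lcGamma, conformalGamma]
      fin_cases i <;> fin_cases j <;> fin_cases k <;> simp
    · simp [lcGamma]
  · rcases α with k | c
    · simp [lcGamma, DMetric.anholonomy]
    · simp only [lcGamma, DMetric.anholonomy, H.pdy_N hu]
      fin_cases b <;> fin_cases c <;> simp
  · rcases α with k | c
    · simp [lcGamma, DMetric.anholonomy]
    · simp only [lcGamma, DMetric.anholonomy, H.pdy_N hu]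
      fin_cases a <;> fin_cases c <;> simp
  · rcases α with k | c
    · simp [lcGamma, DMetric.anholonomy]
    · simp only [lcGamma, DMetric.anholonomy]
      fin_cases a <;> fin_cases b <;> fin_cases c <;> simp

theorem isLCConfiguration (H : IsLCMetric U D ψ h3 h4 n w) : D.IsLCConfiguration U :=
  fun _ hu α β γ => ⟨H.nonmetricity_eq_zero hu α β γ, H.torsion_eq_zero hu α β γ⟩

end IsLCMetric

/-! ### Curvature, Ricci tensor and Killing field of such metrics. -/

/-- `[e_k, ∂_φ] f = ∂_φ w ∂_φ f` for `e_k f = ∂_k f - w ∂_φ f = r`. -/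
theorem pdx_pdy_one {U : Set Pt} (hU : IsOpen U) {u : Pt} (hu : u ∈ U) {f w r : Pt → ℝ}
    (hf : ContDiffOn ℝ ∞ f U) (hw : ContDiffOn ℝ ∞ w U) (hr : ContDiffOn ℝ ∞ r U) {k : Fin 2}
    (h : ∀ p ∈ U, pdx k f p = w p * pdy 1 f p + r p) :
    pdx k (pdy 1 f) u = w u * pdy 1 (pdy 1 f) u + pdy 1 w u * pdy 1 f u + pdy 1 r u := by
  have hd {g : Pt → ℝ} (hg : ContDiffOn ℝ ∞ g U) := smooth_differentiableAt hU hg hu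
  have hf' := smooth_pd (Sum.inr 1) hU hf
  unfold pdx pdy at *
  rw [pd_comm _ _ hU hf hu, pd_congr _ hU h hu,
    pd_add _ ((hd hw).fun_mul (hd hf')) (hd hr), pd_mul _ (hd hw) (hd hf')]
  ring

namespace IsLCMetric

variable {U : Set Pt} {D : DMetric} {ψ h3 h4 : Pt → ℝ} {n w : Fin 2 → Pt → ℝ} {u : Pt}

theorem curvature_eq (H : IsLCMetric U D ψ h3 h4 n w) (hu : u ∈ U) (α β γ δ : Idx) :
    D.curvature α β γ δ u = D.frame γ (lcGamma ψ h3 h4 w α β δ) u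
      - D.frame δ (lcGamma ψ h3 h4 w α β γ) u
      + ∑ τ, (lcGamma ψ h3 h4 w τ β δ u * lcGamma ψ h3 h4 w α τ γ u
        - lcGamma ψ h3 h4 w τ β γ u * lcGamma ψ h3 h4 w α τ δ u
        - D.anholonomy τ γ δ u * lcGamma ψ h3 h4 w α β τ u) := by
  have h (γ β α) := D.frame_congr H.isOpen (fun p hp => H.conn_eq hp γ β α) hu
  simp only [DMetric.curvature, h, H.conn_eq hu]

theorem frame_of_indep (H : IsLCMetric U D ψ h3 h4 n w) (hu : u ∈ U) {f : Pt → ℝ}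
    (hf : pdy 0 f u = 0) (k : Fin 2) :
    D.frame (Sum.inl k) f u = pdx k f u - w k u * pdy 1 f u := by
  rw [D.frame_inl, H.N_one u hu, hf, mul_zero, zero_add]

theorem pd_conformalGamma (H : IsLCMetric U D ψ h3 h4 n w) (hu : u ∈ U) (μ : Idx)
    (i j k : Fin 2) :
    pd μ (conformalGamma ψ i j k) u
      = 1 / 2 * ((if i = j then 1 else 0) * pd μ (pdx k ψ) u
        + (if i = k then 1 else 0) * pd μ (pdx j ψ) u
        - (if j = k then 1 else 0) * pd μ (pdx i ψ) u) := by
  have hd (l : Fin 2) : DifferentiableAt ℝ (pdx l ψ) u :=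
    smooth_differentiableAt H.isOpen (smooth_pd _ H.isOpen H.smooth_psi.smooth) hu
  have hc (c : ℝ) (l : Fin 2) : DifferentiableAt ℝ (fun p => c * pdx l ψ p) u :=
    (hd l).const_mul c
  unfold conformalGamma
  rw [pd_const_mul _ _ (((hc _ _).fun_add (hc _ _)).fun_sub (hc _ _)),
    pd_sub _ ((hc _ _).fun_add (hc _ _)) (hc _ _), pd_add _ (hc _ _) (hc _ _)]
  simp only [pd_const_mul _ _ (hd _)]

theorem pdy_conformalGamma (H : IsLCMetric U D ψ h3 h4 n w) (hu : u ∈ U) (c i j k : Fin 2) :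
    pdy c (conformalGamma ψ i j k) u = 0 := by
  have h (l : Fin 2) : pd (Sum.inr c) (pdx l ψ) u = 0 := by
    have hs := H.smooth_psi
    fin_cases c
    · exact hs.indep3.pd _ _ H.isOpen hs.smooth u hu
    · exact hs.indep4.pd _ _ H.isOpen hs.smooth u hu
  unfold pdy
  simp [H.pd_conformalGamma hu, h]

theorem frame_conformalGamma (H : IsLCMetric U D ψ h3 h4 n w) (hu : u ∈ U) (l i j k : Fin 2) :
    D.frame (Sum.inl l) (conformalGamma ψ i j k) u
      = 1 / 2 * ((if i = j then 1 else 0) * pdx l (pdx k ψ) u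
        + (if i = k then 1 else 0) * pdx l (pdx j ψ) u
        - (if j = k then 1 else 0) * pdx l (pdx i ψ) u) := by
  rw [D.frame_inl, H.pdy_conformalGamma hu, H.pdy_conformalGamma hu]
  simp only [mul_zero, add_zero, sub_zero]
  exact H.pd_conformalGamma hu _ _ _ _

theorem pd_halfLog (hU : IsOpen U) (hu : u ∈ U) {h : Pt → ℝ} (hs : ContDiffOn ℝ ∞ h U)
    (h0 : h u ≠ 0) (μ : Idx) :
    pd μ (halfLog h) u = (pd μ (pdy 1 h) u * h u - pdy 1 h u * pd μ h u) / (2 * h u ^ 2) := by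
  have hd := smooth_differentiableAt hU hs hu
  unfold halfLog
  rw [pd_div _ (smooth_differentiableAt hU (smooth_pd _ hU hs) hu) (hd.const_mul 2)
    (mul_ne_zero two_ne_zero h0), pd_const_mul _ _ hd]
  field_simp

theorem pdy_zero_halfLog (hU : IsOpen U) (hu : u ∈ U) {h : Pt → ℝ} (hs : SmoothXPhi U h)
    (h0 : h u ≠ 0) : pdy 0 (halfLog h) u = 0 := by
  unfold pdy
  rw [pd_halfLog hU hu hs.smooth h0, hs.indep3.pd _ _ hU hs.smooth u hu, hs.indep3 u hu]
  simp

/-- As e_k h₃ = 0, only the commutator [e_k, ∂_φ] acting on h₃ contributes. -/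
theorem frame_halfLog_h3 (H : IsLCMetric U D ψ h3 h4 n w) (hu : u ∈ U) (k : Fin 2) :
    D.frame (Sum.inl k) (halfLog h3) u = pdy 1 (w k) u * halfLog h3 u := by
  have hs := H.smooth_h3
  have h0 := H.h3_ne u hu
  have h1 := pdx_pdy_one H.isOpen hu hs.smooth (H.smooth_w k).smooth (k := k) (r := fun _ => 0) contDiffOn_const
    (fun p hp => by rw [H.pdx_h3 p hp, add_zero])
  have h2 : pdy 1 (fun _ => (0 : ℝ)) u = 0 := pd_const _ _
  rw [H.frame_of_indep hu (pdy_zero_halfLog H.isOpen hu hs h0)]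
  have h3 := H.pdx_h3 u hu k
  unfold pdx pdy at *
  rw [pd_halfLog H.isOpen hu hs.smooth h0, pd_halfLog H.isOpen hu hs.smooth h0, halfLog]
  unfold pdy
  rw [h1, h2, h3]
  field_simp
  ring

/-- Beyond the commutator term, e_k ln|h₄| = 2 ∂_φw_k contributes half of its φ-derivative. -/
theorem frame_halfLog_h4 (H : IsLCMetric U D ψ h3 h4 n w) (hu : u ∈ U) (k : Fin 2) :
    D.frame (Sum.inl k) (halfLog h4) u
      = pdy 1 (w k) u * halfLog h4 u + pdy 1 (pdy 1 (w k)) u := by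
  have hs := H.smooth_h4
  have h0 := H.h4_ne u hu
  have hw := smooth_pd (Sum.inr 1) H.isOpen (H.smooth_w k).smooth
  have hd {g : Pt → ℝ} (hg : ContDiffOn ℝ ∞ g U) := smooth_differentiableAt H.isOpen hg hu
  have h1 := pdx_pdy_one H.isOpen hu hs.smooth (H.smooth_w k).smooth (k := k) (r := fun p => 2 * pdy 1 (w k) p * h4 p)
    ((contDiffOn_const.mul hw).mul hs.smooth) (fun p hp => H.pdx_h4 p hp k)
  have h2 : pdy 1 (fun p => 2 * pdy 1 (w k) p * h4 p) u
      = 2 * pdy 1 (pdy 1 (w k)) u * h4 u + 2 * pdy 1 (w k) u * pdy 1 h4 u := by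
    unfold pdy
    rw [pd_mul _ ((hd hw).const_mul 2) (hd hs.smooth), pd_const_mul _ _ (hd hw)]
  rw [H.frame_of_indep hu (pdy_zero_halfLog H.isOpen hu hs h0)]
  have h3 := H.pdx_h4 u hu k
  unfold pdx pdy at *
  rw [pd_halfLog H.isOpen hu hs.smooth h0, pd_halfLog H.isOpen hu hs.smooth h0, halfLog]
  unfold pdy
  rw [h1, h2, h3]
  field_simp
  ring

theorem lineElement_eq (H : IsLCMetric U D ψ h3 h4 n w) (hu : u ∈ U) (v : Pt) :
    D.lineElement u v = Real.exp (ψ u) * (v (Sum.inl 0) ^ 2 + v (Sum.inl 1) ^ 2)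
      + h3 u * (v (Sum.inr 0) + ∑ k, n k u * v (Sum.inl k)) ^ 2
      + h4 u * (v (Sum.inr 1) + ∑ k, w k u * v (Sum.inl k)) ^ 2 := by
  simp [DMetric.lineElement, DMetric.coordMetric, Fintype.sum_sum_type, Fin.sum_univ_two,
    DMetric.metric, DMetric.coframe, H.g_eq u hu, H.h_eq u hu, H.N_zero u hu, H.N_one u hu]
  ring

theorem pd_coordMetric (H : IsLCMetric U D ψ h3 h4 n w) (hu : u ∈ U) (μ ν : Idx) :
    pd (Sum.inr 0) (D.coordMetric μ ν) u = 0 := by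
  -- Differentiable with zero y³-derivative: a class closed under sums and products, so it suffices
  -- to test the building blocks of the metric.
  let C (f : Pt → ℝ) : Prop := DifferentiableAt ℝ f u ∧ pd (Sum.inr 0) f u = 0
  have C0 (c : ℝ) : C fun _ => c := ⟨differentiableAt_const c, pd_const _ _⟩
  have Cadd {f g : Pt → ℝ} (hf : C f) (hg : C g) : C fun p => f p + g p :=
    ⟨hf.1.fun_add hg.1, by rw [pd_add _ hf.1 hg.1, hf.2, hg.2, add_zero]⟩
  have Cmul {f g : Pt → ℝ} (hf : C f) (hg : C g) : C fun p => f p * g p :=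
    ⟨hf.1.fun_mul hg.1, by rw [pd_mul _ hf.1 hg.1, hf.2, hg.2]; ring⟩
  have Cs {f : Pt → ℝ} (hf : SmoothXPhi U f) : C f :=
    ⟨smooth_differentiableAt H.isOpen hf.smooth hu, hf.indep3 u hu⟩
  have Cx {f : Pt → ℝ} (hf : SmoothX U f) : C f := Cs ⟨hf.smooth, hf.indep3⟩
  have Ccongr {f g : Pt → ℝ} (h : ∀ p ∈ U, f p = g p) (hg : C g) : C f :=
    ⟨hg.1.congr_of_eventuallyEq (Filter.eventually_of_mem (H.isOpen.mem_nhds hu) h),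
      by rw [pd_congr _ H.isOpen h hu, hg.2]⟩
  have hψ := Cx H.smooth_psi
  have Cexp : C fun p => Real.exp (ψ p) := ⟨hψ.1.exp, by rw [pd_exp _ hψ.1, hψ.2, mul_zero]⟩
  have Cmetric (α β : Idx) : C (D.metric α β) := by
    rcases α with i | a <;> rcases β with j | b
    · refine Ccongr (g := fun p => if i = j then Real.exp (ψ p) else 0)
        (fun p hp => by simp [DMetric.metric, H.g_eq p hp, Matrix.diagonal_apply]) ?_
      split_ifs
      exacts [Cexp, C0 0]
    · exact C0 0
    · exact C0 0
    · refine Ccongr (g := ![![h3, fun _ => 0], ![fun _ => 0, h4]] a b) (fun p hp => by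
        fin_cases a <;> fin_cases b <;> simp [DMetric.metric, H.h_eq p hp]) ?_
      fin_cases a <;> fin_cases b
      exacts [Cs H.smooth_h3, C0 0, C0 0, Cs H.smooth_h4]
  have Cframe (α β : Idx) : C fun p => D.coframe p α β := by
    rcases α with i | a <;> rcases β with j | b
    · exact C0 _
    · exact C0 0
    · refine Ccongr (g := ![n j, w j] a) (fun p hp => by
        fin_cases a <;> simp [DMetric.coframe, H.N_zero p hp, H.N_one p hp]) ?_
      fin_cases a
      exacts [Cx (H.smooth_n j), Cs (H.smooth_w j)]
    · exact C0 _
  have Csum (F : Idx → Pt → ℝ) (hF : ∀ α, C (F α)) : C fun p => ∑ α, F α p := by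
    simp only [Fintype.sum_sum_type, Fin.sum_univ_two]
    exact Cadd (Cadd (hF _) (hF _)) (Cadd (hF _) (hF _))
  exact (Csum _ fun α => Csum _ fun β =>
    Cmul (Cmul (Cmetric α β) (Cframe α μ)) (Cframe β ν)).2

theorem isKilling (H : IsLCMetric U D ψ h3 h4 n w) :
    D.IsKilling U (fun _ => Pi.single (Sum.inr 0) 1) := by
  intro u hu μ ν
  refine Finset.sum_eq_zero fun τ _ => ?_
  simp only [pd_const, mul_zero, add_zero]
  by_cases h : τ = Sum.inr 0
  · rw [h, H.pd_coordMetric hu, mul_zero]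
  · rw [Pi.single_eq_of_ne h, zero_mul]

/-- No coefficient mixes horizontal with vertical indices, so this is the Ricci tensor of the
surface e^ψ((dx¹)² + (dx²)²). -/
theorem ricci_inl_inl (H : IsLCMetric U D ψ h3 h4 n w) (hu : u ∈ U) (i j : Fin 2) :
    D.ricci (Sum.inl i) (Sum.inl j) u
      = if i = j then -(1 / 2) * (pdx 0 (pdx 0 ψ) u + pdx 1 (pdx 1 ψ) u) else 0 := by
  have hc := pd_comm (Sum.inl 0) (Sum.inl 1) H.isOpen H.smooth_psi.smooth hu
  simp only [DMetric.ricci, H.curvature_eq hu, Fintype.sum_sum_type, Fin.sum_univ_two,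
    lcGamma, D.frame_zero, H.frame_conformalGamma hu, H.anholonomy_inl_inl hu]
  fin_cases i <;> fin_cases j <;> simp [conformalGamma, hc] <;> ring

theorem ricci_inl_inr (H : IsLCMetric U D ψ h3 h4 n w) (hu : u ∈ U) (i a : Fin 2) :
    D.ricci (Sum.inl i) (Sum.inr a) u = 0 := by
  have h1 : pdy a (fun _ => (0 : ℝ)) u = 0 := pd_const _ _
  simp [DMetric.ricci, H.curvature_eq hu, Fintype.sum_sum_type, h1,
    lcGamma, D.frame_zero, D.frame_inr, H.pdy_conformalGamma hu, DMetric.anholonomy]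

/-- Only the φ-component needs work. Its y³ part is ∂_φw halfLog(h₃) − e_k halfLog(h₃), its φ part
is ∂²_φw + ∂_φw halfLog(h₄) − e_k halfLog(h₄); both vanish by the two preceding frame derivatives of
`halfLog`. -/
theorem ricci_inr_inl (H : IsLCMetric U D ψ h3 h4 n w) (hu : u ∈ U) (a i : Fin 2) :
    D.ricci (Sum.inr a) (Sum.inl i) u = 0 := by
  have h1 : pdy 0 (fun _ => (0 : ℝ)) u = 0 := pd_const _ _
  have h2 : pdy 1 (fun _ => (0 : ℝ)) u = 0 := pd_const _ _
  simp only [DMetric.ricci, H.curvature_eq hu, Fintype.sum_sum_type, Fin.sum_univ_two,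
    lcGamma, DMetric.anholonomy, H.pdy_N hu, D.frame_inr]
  fin_cases a <;> simp [D.frame_zero, H.frame_halfLog_h3 hu, H.frame_halfLog_h4 hu, h1, h2]
  ring

/-- The vertical fibre is a surface, so its Ricci tensor is pure trace, and only φ-derivatives of h₃
and h₄ occur. -/
theorem ricci_inr_inr (H : IsLCMetric U D ψ h3 h4 n w) (hu : u ∈ U) (a b : Fin 2) :
    D.ricci (Sum.inr a) (Sum.inr b) u
      = -(1 / (2 * h3 u * h4 u)) * (pdy 1 (pdy 1 h3) u - pdy 1 h3 u ^ 2 / (2 * h3 u)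
        - pdy 1 h3 u * pdy 1 h4 u / (2 * h4 u)) * D.h u a b := by
  have h3_ne := H.h3_ne u hu
  have h4_ne := H.h4_ne u hu
  have hd {g : Pt → ℝ} (hg : ContDiffOn ℝ ∞ g U) := smooth_differentiableAt H.isOpen hg hu
  have h1 (c : Fin 2) : pdy c (fun _ => (0 : ℝ)) u = 0 := pd_const _ _
  have e3 : pdy 0 (halfLog h3) u = 0 := pdy_zero_halfLog H.isOpen hu H.smooth_h3 h3_ne
  have e4 : pdy 0 (halfLog h4) u = 0 := pdy_zero_halfLog H.isOpen hu H.smooth_h4 h4_ne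
  have e3' : pdy 1 (halfLog h3) u = _ := pd_halfLog H.isOpen hu H.smooth_h3.smooth h3_ne _
  have hq : pdy 1 (fun p => -pdy 1 h3 p / (2 * h4 p)) u
      = -(pdy 1 (pdy 1 h3) u * h4 u - pdy 1 h3 u * pdy 1 h4 u) / (2 * h4 u ^ 2) := by
    have hn := hd (smooth_pd (Sum.inr 1) H.isOpen H.smooth_h3.smooth)
    unfold pdy
    rw [pd_div _ hn.fun_neg ((hd H.smooth_h4.smooth).const_mul 2)
      (mul_ne_zero two_ne_zero h4_ne), pd_neg, pd_const_mul _ _ (hd H.smooth_h4.smooth)]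
    field_simp
    ring
  simp only [DMetric.ricci, H.curvature_eq hu, Fintype.sum_sum_type, Fin.sum_univ_two,
    lcGamma, DMetric.anholonomy, D.frame_inr, H.h_eq u hu]
  fin_cases a <;> fin_cases b <;> simp [D.frame_zero, h1, e3, e4, e3', hq] <;>
    simp only [halfLog] <;> field_simp <;> ring

end IsLCMetric
-- The prime Kerr data.
variable {U : Set Pt} {u : Pt}

theorem pd_comp_pair {F : ℝ × ℝ → ℝ} {r ϑ : Pt → ℝ} (μ : Idx)
    (hF : DifferentiableAt ℝ F (r u, ϑ u)) (hr : DifferentiableAt ℝ r u)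
    (hϑ : DifferentiableAt ℝ ϑ u) :
    pd μ (fun p => F (r p, ϑ p)) u = fderiv ℝ F (r u, ϑ u) (pd μ r u, pd μ ϑ u) := by
  have h := (HasFDerivAt.comp u (g := F) (f := fun p => (r p, ϑ p)) hF.hasFDerivAt
    (hr.hasFDerivAt.prodMk hϑ.hasFDerivAt)).fderiv
  simp only [Function.comp_def] at h
  simp [pd, h]

theorem SmoothX.comp_pair (hU : IsOpen U) {F : ℝ × ℝ → ℝ} {r ϑ : Pt → ℝ} (hr : SmoothX U r)
    (hϑ : SmoothX U ϑ) (hF : ∀ u ∈ U, ContDiffAt ℝ ∞ F (r u, ϑ u)) :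
    SmoothX U (fun p => F (r p, ϑ p)) where
  smooth u hu := ((hF u hu).comp u (f := fun p => (r p, ϑ p))
    ((hr.smooth.contDiffAt (hU.mem_nhds hu)).prodMk
      (hϑ.smooth.contDiffAt (hU.mem_nhds hu)))).contDiffWithinAt
  indep3 u hu := by
    rw [pd_comp_pair _ ((hF u hu).differentiableAt (by simp))
      (smooth_differentiableAt hU hr.smooth hu) (smooth_differentiableAt hU hϑ.smooth hu),
      hr.indep3 u hu, hϑ.indep3 u hu, ← Prod.zero_eq_mk, map_zero]
  indep4 u hu := by
    rw [pd_comp_pair _ ((hF u hu).differentiableAt (by simp))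
      (smooth_differentiableAt hU hr.smooth hu) (smooth_differentiableAt hU hϑ.smooth hu),
      hr.indep4 u hu, hϑ.indep4 u hu, ← Prod.zero_eq_mk, map_zero]

theorem SmoothX.pdx (hU : IsOpen U) {f : Pt → ℝ} (hf : SmoothX U f) (k : Fin 2) :
    SmoothX U (pdx k f) :=
  ⟨smooth_pd _ hU hf.smooth, hf.indep3.pd _ _ hU hf.smooth, hf.indep4.pd _ _ hU hf.smooth⟩

theorem SmoothXPhi.pd (hU : IsOpen U) {f : Pt → ℝ} (hf : SmoothXPhi U f) (μ : Idx) :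
    SmoothXPhi U (pd μ f) :=
  ⟨smooth_pd _ hU hf.smooth, hf.indep3.pd _ _ hU hf.smooth⟩

/-- With R = r² + a² and q = a² sin²ϑ, the numerator is −Δ sin²ϑ (R − q)², and R − q is the
denominator `kerrSigma`. This keeps h̊₄ away from zero. -/
theorem kerrA_mul_kerrC_sub {m₀ a r ϑ : ℝ} (h : kerrSigma a r ϑ ≠ 0) :
    kerrA m₀ a r ϑ * kerrC m₀ a r ϑ - kerrB m₀ a r ϑ ^ 2
      = -(kerrDelta m₀ a r * Real.sin ϑ ^ 2) := by
  have hc : kerrSigma a r ϑ = r ^ 2 + a ^ 2 - a ^ 2 * Real.sin ϑ ^ 2 := by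
    rw [kerrSigma, Real.cos_sq']; ring
  unfold kerrA kerrB kerrC
  field_simp
  rw [hc]
  ring

namespace KerrChart

variable {K : KerrChart}

/-- Division by zero yields 0, so a vanishing denominator would force Ā = 0. -/
theorem Admissible.sigma_ne (hK : K.Admissible U) (hu : u ∈ U) :
    kerrSigma K.a (K.r u) (K.ϑ u) ≠ 0 := fun h =>
  hK.A_ne u hu (by simp [A, kerrA, h])

theorem Admissible.smoothX_A (hU : IsOpen U) (hK : K.Admissible U) : SmoothX U K.A := by
  refine SmoothX.comp_pair hU (F := fun q => kerrA K.m₀ K.a q.1 q.2) hK.smooth_r hK.smooth_theta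
    fun u hu => ?_
  have h := hK.sigma_ne hu
  unfold kerrA
  refine ContDiffAt.div ?_ ?_ h
  · unfold kerrDelta; fun_prop
  · unfold kerrSigma; fun_prop

theorem Admissible.smoothX_B (hU : IsOpen U) (hK : K.Admissible U) : SmoothX U K.B := by
  refine SmoothX.comp_pair hU (F := fun q => kerrB K.m₀ K.a q.1 q.2) hK.smooth_r hK.smooth_theta
    fun u hu => ?_
  have h := hK.sigma_ne hu
  unfold kerrB
  refine ContDiffAt.div ?_ ?_ h
  · unfold kerrDelta; fun_prop
  · unfold kerrSigma; fun_prop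

theorem Admissible.disc_ne (hK : K.Admissible U) (hu : u ∈ U) :
    K.A u * K.C u - K.B u ^ 2 ≠ 0 := by
  unfold A B C
  rw [kerrA_mul_kerrC_sub (hK.sigma_ne hu)]
  exact neg_ne_zero.mpr (mul_ne_zero (hK.delta_pos u hu).ne' (pow_ne_zero 2 (hK.sin_ne u hu)))

theorem Admissible.h4Prime_eq (hK : K.Admissible U) (hu : u ∈ U) :
    K.h4Prime u = (K.A u * K.C u - K.B u ^ 2) / K.A u := by
  have := hK.A_ne u hu
  unfold h4Prime
  field_simp

theorem Admissible.h4Prime_ne (hK : K.Admissible U) (hu : u ∈ U) : K.h4Prime u ≠ 0 := by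
  rw [hK.h4Prime_eq hu]
  exact div_ne_zero (hK.disc_ne hu) (hK.A_ne u hu)

/-- Ā and B̄ do not depend on φ, so φB̄/Ā has φ-derivative B̄/Ā, which ∂_φŷ³ cancels. -/
theorem Admissible.smoothX_shift (hU : IsOpen U) (hK : K.Admissible U) : SmoothX U K.shift := by
  have hA := hK.smoothX_A hU
  have hB := hK.smoothX_B hU
  have hq : ContDiffOn ℝ ∞ (fun u => K.B u / K.A u) U := hB.smooth.div hA.smooth hK.A_ne
  have hφ : ContDiffOn ℝ ∞ (fun u : Pt => u (Sum.inr 1)) U := contDiffOn_pi.mp contDiffOn_id _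
  have hd {f : Pt → ℝ} (hf : ContDiffOn ℝ ∞ f U) {u} (hu : u ∈ U) :=
    smooth_differentiableAt hU hf hu
  have key (μ : Idx) {u} (hu : u ∈ U) (h1 : pd μ K.A u = 0) (h2 : pd μ K.B u = 0) :
      pd μ K.shift u = pd μ K.yHat u + (if μ = Sum.inr 1 then 1 else 0) * (K.B u / K.A u) := by
    unfold shift
    rw [pd_add _ (hd hK.smooth_yHat.smooth hu) (hd (hφ.mul hq) hu),
      pd_mul _ (hd hφ hu) (hd hq hu), pd_coord,
      pd_div _ (hd hB.smooth hu) (hd hA.smooth hu) (hK.A_ne u hu), h1, h2]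
    simp
  refine ⟨hK.smooth_yHat.smooth.add (hφ.mul hq), fun u hu => ?_, fun u hu => ?_⟩
  · rw [key _ hu (hA.indep3 u hu) (hB.indep3 u hu), hK.smooth_yHat.indep3 u hu]
    simp
  · have := hK.yHat_phi u hu
    unfold pdy at this
    rw [key _ hu (hA.indep4 u hu) (hB.indep4 u hu), this]
    simp

theorem Admissible.fderiv_t (hU : IsOpen U) (hK : K.Admissible U) (hu : u ∈ U) (v : Pt) :
    fderiv ℝ K.t u v = v (Sum.inr 0) + ∑ k, K.nPrime k u * v (Sum.inl k) := by
  have hs := hK.smoothX_shift hU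
  have h3 := hs.indep3 u hu
  have h4 := hs.indep4 u hu
  have key (μ : Idx) : pd μ K.t u = (if μ = Sum.inr 0 then 1 else 0) - pd μ K.shift u := by
    unfold t
    rw [pd_sub _ (differentiableAt_coord _) (smooth_differentiableAt hU hs.smooth hu), pd_coord]
  simp [fderiv_eq_sum_pd, key, Fintype.sum_sum_type, Fin.sum_univ_two, h3, h4, nPrime]
  ring

theorem Admissible.kerrLineElement_eq (hU : IsOpen U) (hK : K.Admissible U) (hu : u ∈ U)
    (v : Pt) :
    kerrLineElement K.m₀ K.a (K.r u) (K.ϑ u) (fderiv ℝ K.t u v) (fderiv ℝ K.r u v)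
        (fderiv ℝ K.ϑ u v) (v (Sum.inr 1))
      = K.gPrime u * (v (Sum.inl 0) ^ 2 + v (Sum.inl 1) ^ 2)
        + K.A u * (v (Sum.inr 0) + ∑ k, K.nPrime k u * v (Sum.inl k)
            + K.B u / K.A u * v (Sum.inr 1)) ^ 2
        + K.h4Prime u * v (Sum.inr 1) ^ 2 := by
  have hA := hK.A_ne u hu
  have e00 := hK.isothermal u hu 0 0
  have e01 := hK.isothermal u hu 0 1
  have e11 := hK.isothermal u hu 1 1
  have hx {f : Pt → ℝ} (hf : SmoothX U f) : fderiv ℝ f u v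
      = pdx 0 f u * v (Sum.inl 0) + pdx 1 f u * v (Sum.inl 1) := by
    simp [fderiv_eq_sum_pd, Fintype.sum_sum_type, Fin.sum_univ_two, hf.indep3 u hu,
      hf.indep4 u hu]
  rw [hK.fderiv_t hU hu v, hx hK.smooth_r, hx hK.smooth_theta]
  simp only [if_true, zero_ne_one, if_false] at e00 e01 e11
  -- Completing the square in dt.
  have hv : ∀ T φ : ℝ, K.A u * T ^ 2 + 2 * K.B u * T * φ + K.C u * φ ^ 2
      = K.A u * (T + K.B u / K.A u * φ) ^ 2 + K.h4Prime u * φ ^ 2 := fun T φ => by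
    unfold h4Prime
    field_simp
    ring
  have := hv (v (Sum.inr 0) + ∑ k, K.nPrime k u * v (Sum.inl k)) (v (Sum.inr 1))
  unfold A B C at *
  unfold kerrLineElement
  -- The isothermal identities, weighted by (dx¹)², 2dx¹dx² and (dx²)², convert the (r, ϑ)-part.
  linear_combination v (Sum.inl 0) ^ 2 * e00 + 2 * v (Sum.inl 0) * v (Sum.inl 1) * e01
    + v (Sum.inl 1) ^ 2 * e11 + this

end KerrChart

/-! ### The generating data and the target metric. -/

/-- Meant for s = √|e|: the hypothesis `hd` is the derivative of s⁴ = e², which avoids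
differentiating the absolute value. Squaring it brings in s⁶ = |e|³, and the sign of e settles the
rest. -/
theorem sign_mul_sq_of_sqrt_abs {e s d e' : ℝ} (he : e ≠ 0) (hs : s ^ 2 = |e|)
    (hd : 4 * s ^ 3 * d = 2 * e * e') : Real.sign e * d ^ 2 = e' ^ 2 / (4 * e) := by
  have h1 : 16 * |e| ^ 3 * d ^ 2 = 4 * e ^ 2 * e' ^ 2 := by
    rw [← hs]; linear_combination (4 * s ^ 3 * d + 2 * e * e') * hd
  rcases lt_or_gt_of_ne he with h | h
  · rw [Real.sign_of_neg h]
    rw [abs_of_neg h] at h1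
    field_simp
    refine mul_left_cancel₀ (mul_ne_zero four_ne_zero (pow_ne_zero 2 he)) ?_
    linear_combination h1
  · rw [Real.sign_of_pos h]
    rw [abs_of_pos h] at h1
    field_simp
    refine mul_left_cancel₀ (mul_ne_zero four_ne_zero (pow_ne_zero 2 he)) ?_
    linear_combination h1

namespace GenData.Admissible

variable {U : Set Pt} {u : Pt} {K : KerrChart} {P : GenData}

theorem Phi_sq (hP : P.Admissible K U) (hu : u ∈ U) :
    P.Phi K u ^ 2 = 4 * P.Lam0 * K.A u * P.eta3 u := Real.sq_sqrt (hP.Phi_sq_pos u hu).le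

theorem Phi_ne (hP : P.Admissible K U) (hu : u ∈ U) : P.Phi K u ≠ 0 :=
  (Real.sqrt_pos.mpr (hP.Phi_sq_pos u hu)).ne'

theorem eta3_ne (hP : P.Admissible K U) (hu : u ∈ U) : P.eta3 u ≠ 0 := fun h => by
  have := hP.Phi_sq_pos u hu
  simp [h] at this

theorem smooth_Phi (hU : IsOpen U) (hK : K.Admissible U) (hP : P.Admissible K U) :
    ContDiffOn ℝ ∞ (P.Phi K) U :=
  ((contDiffOn_const.mul (hK.smoothX_A hU).smooth).mul hP.smooth_eta3.smooth).sqrt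
    fun u hu => (hP.Phi_sq_pos u hu).ne'

/-- Differentiating Φ̃² rather than the square root, in a direction along which Ā is constant. -/
theorem two_mul_Phi_mul_pd (hU : IsOpen U) (hK : K.Admissible U) (hP : P.Admissible K U)
    (hu : u ∈ U) {μ : Idx} (hμ : pd μ K.A u = 0) :
    2 * P.Phi K u * pd μ (P.Phi K) u = 4 * P.Lam0 * K.A u * pd μ P.eta3 u := by
  have hA := smooth_differentiableAt hU (hK.smoothX_A hU).smooth hu
  rw [← pd_sq _ (smooth_differentiableAt hU (hP.smooth_Phi hU hK) hu),
    pd_congr _ hU (fun p hp => hP.Phi_sq hp) hu,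
    pd_mul _ (hA.const_mul _) (smooth_differentiableAt hU hP.smooth_eta3.smooth hu),
    pd_const_mul _ _ hA, hμ]
  ring

theorem smoothXPhi_Phi (hU : IsOpen U) (hK : K.Admissible U) (hP : P.Admissible K U) :
    SmoothXPhi U (P.Phi K) := by
  refine ⟨hP.smooth_Phi hU hK, fun u hu => ?_⟩
  have h := hP.two_mul_Phi_mul_pd hU hK hu ((hK.smoothX_A hU).indep3 u hu)
  rw [hP.smooth_eta3.indep3 u hu, mul_zero] at h
  simpa [hP.Phi_ne hu] using h

theorem Phi_phi_ne (hU : IsOpen U) (hK : K.Admissible U) (hP : P.Admissible K U) (hu : u ∈ U) :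
    pdy 1 (P.Phi K) u ≠ 0 := fun h0 => by
  have h := hP.two_mul_Phi_mul_pd hU hK hu ((hK.smoothX_A hU).indep4 u hu)
  have h1 := hP.eta3_phi_ne u hu
  unfold pdy at h0 h1
  rw [h0, mul_zero] at h
  simp [hP.Lam0_ne, hK.A_ne u hu, h1] at h

theorem Xi_phi (hU : IsOpen U) (hK : K.Admissible U) (hP : P.Admissible K U) (hu : u ∈ U) :
    pdy 1 P.Xi u = P.vLam u * (2 * P.Phi K u * pdy 1 (P.Phi K) u) := by
  rw [hP.Xi_primitive u hu]
  unfold pdy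
  rw [pd_sq _ (smooth_differentiableAt hU (hP.smooth_Phi hU hK) hu)]

theorem Xi_phi_ne (hU : IsOpen U) (hK : K.Admissible U) (hP : P.Admissible K U) (hu : u ∈ U) :
    pdy 1 P.Xi u ≠ 0 := by
  rw [hP.Xi_phi hU hK hu]
  exact mul_ne_zero (hP.vLam_ne u hu)
    (mul_ne_zero (mul_ne_zero two_ne_zero (hP.Phi_ne hu)) (hP.Phi_phi_ne hU hK hu))

theorem pdx_Xi (hU : IsOpen U) (hK : K.Admissible U) (hP : P.Admissible K U) (hu : u ∈ U)
    (k : Fin 2) : pdx k P.Xi u = pdx k P.A u * pdy 1 P.Xi u := by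
  rw [hP.potential u hu, div_mul_cancel₀ _ (hP.Xi_phi_ne hU hK hu)]

/-- All partials of Φ̃ = H(Ξ) are those of Ξ times the same factor H′(Ξ), so Φ̃ inherits the
transport equation of Ξ. -/
theorem pdx_Phi (hU : IsOpen U) (hK : K.Admissible U) (hP : P.Admissible K U) (hu : u ∈ U)
    (k : Fin 2) : pdx k (P.Phi K) u = pdx k P.A u * pdy 1 (P.Phi K) u := by
  obtain ⟨H, hH⟩ := hP.functional
  have hc (μ : Idx) : pd μ (P.Phi K) u = deriv H (P.Xi u) * pd μ P.Xi u := by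
    rw [pd_congr _ hU (fun p hp => (hH p hp).2) hu, pd_comp _ (hH u hu).1
      (smooth_differentiableAt hU hP.smooth_Xi.smooth hu)]
  have h := hP.pdx_Xi hU hK hu k
  unfold pdx pdy at *
  rw [hc, hc, h]
  ring

theorem pdx_pdy_of_transport (hU : IsOpen U) (hP : P.Admissible K U) (hu : u ∈ U) {f : Pt → ℝ}
    (hf : ContDiffOn ℝ ∞ f U) {k : Fin 2} (h : ∀ p ∈ U, pdx k f p = pdx k P.A p * pdy 1 f p) :
    pdx k (pdy 1 f) u
      = pdx k P.A u * pdy 1 (pdy 1 f) u + pdy 1 (pdx k P.A) u * pdy 1 f u := by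
  rw [pdx_pdy_one hU hu hf (smooth_pd _ hU hP.smooth_A.smooth) (r := fun _ => 0)
    contDiffOn_const (fun p hp => by rw [h p hp, add_zero])]
  unfold pdy
  rw [pd_const, add_zero]

theorem smoothX_n (hU : IsOpen U) (hK : K.Admissible U) (hP : P.Admissible K U) :
    SmoothX U (fun u => P.n u - K.shift u) := by
  have hs := hK.smoothX_shift hU
  have hn := hP.smooth_n
  have hd {f : Pt → ℝ} (hf : ContDiffOn ℝ ∞ f U) {u} (hu : u ∈ U) :=
    smooth_differentiableAt hU hf hu
  refine ⟨hn.smooth.sub hs.smooth, fun u hu => ?_, fun u hu => ?_⟩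
  · rw [pd_sub _ (hd hn.smooth hu) (hd hs.smooth hu), hn.indep3 u hu, hs.indep3 u hu, sub_zero]
  · rw [pd_sub _ (hd hn.smooth hu) (hd hs.smooth hu), hn.indep4 u hu, hs.indep4 u hu, sub_zero]

/-- Equality of the mixed partials of Ξ, expanded by the transport equation, is the claimed symmetry
multiplied by ∂_φΞ ≠ 0. -/
theorem closed_w (hU : IsOpen U) (hK : K.Admissible U) (hP : P.Admissible K U) (hu : u ∈ U)
    (i j : Fin 2) : pdx i (pdx j P.A) u - pdx i P.A u * pdy 1 (pdx j P.A) u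
      = pdx j (pdx i P.A) u - pdx j P.A u * pdy 1 (pdx i P.A) u := by
  have hXi := hP.smooth_Xi.smooth
  have hd {f : Pt → ℝ} (hf : ContDiffOn ℝ ∞ f U) := smooth_differentiableAt hU hf hu
  have second (k l : Fin 2) : pdx k (pdx l P.Xi) u
      = pdx k (pdx l P.A) u * pdy 1 P.Xi u + pdx l P.A u * (pdx k P.A u * pdy 1 (pdy 1 P.Xi) u
        + pdy 1 (pdx k P.A) u * pdy 1 P.Xi u) := by
    rw [← hP.pdx_pdy_of_transport hU hu hXi (fun p hp => hP.pdx_Xi hU hK hp k)]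
    have h := fun p hp => hP.pdx_Xi (u := p) hU hK hp l
    unfold pdx pdy at *
    rw [pd_congr _ hU h hu, pd_mul _ (hd (smooth_pd _ hU hP.smooth_A.smooth))
      (hd (smooth_pd _ hU hXi))]
  have hA : pdx i (pdx j P.A) u = pdx j (pdx i P.A) u :=
    pd_comm _ _ hU hP.smooth_A.smooth hu
  have hX : pdx i (pdx j P.Xi) u = pdx j (pdx i P.Xi) u := pd_comm _ _ hU hXi hu
  rw [second, second, hA] at hX
  rw [hA]
  refine mul_right_cancel₀ (hP.Xi_phi_ne hU hK hu) ?_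
  linear_combination hX

theorem eta4_mul_h4Prime (hK : K.Admissible U) (hu : u ∈ U) :
    P.eta4 K u * K.h4Prime u = pdy 1 (P.Phi K) u ^ 2 / P.Xi u := by
  have := hK.h4Prime_ne hu
  unfold eta4
  rw [← div_div, div_mul_cancel₀ _ this]

theorem eps_mul_eta3_mul_A (hP : P.Admissible K U) (hu : u ∈ U) :
    P.ε * (P.eta3 u * K.A u) = P.ε / (4 * P.Lam0) * P.Phi K u ^ 2 := by
  have := hP.Lam0_ne
  rw [hP.Phi_sq hu]
  field_simp

theorem eps_ne (hP : P.Admissible K U) : P.ε ≠ 0 := by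
  rcases hP.sign with h | h <;> simp [h]

theorem pd_sq_div_Xi (hU : IsOpen U) (hP : P.Admissible K U) (hu : u ∈ U) {f : Pt → ℝ}
    (hf : ContDiffOn ℝ ∞ f U) (μ : Idx) :
    pd μ (fun p => f p ^ 2 / P.Xi p) u
      = (2 * f u * pd μ f u * P.Xi u - f u ^ 2 * pd μ P.Xi u) / P.Xi u ^ 2 := by
  have hd := smooth_differentiableAt hU hf hu
  rw [pd_div _ (hd.fun_pow 2) (smooth_differentiableAt hU hP.smooth_Xi.smooth hu)
    (hP.Xi_ne u hu), pd_sq _ hd]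

theorem isLCMetric_target (hU : IsOpen U) (hK : K.Admissible U) (hP : P.Admissible K U) :
    IsLCMetric U (P.target K) P.ψ (fun u => P.ε / (4 * P.Lam0) * P.Phi K u ^ 2)
      (fun u => pdy 1 (P.Phi K) u ^ 2 / P.Xi u) (fun k => pdx k fun u => P.n u - K.shift u)
      (fun k => pdx k P.A) := by
  have hΦ := hP.smoothXPhi_Phi hU hK
  have hΦ' := hΦ.pd hU (Sum.inr 1)
  have hn := hP.smoothX_n hU hK
  have hd {f : Pt → ℝ} (hf : ContDiffOn ℝ ∞ f U) {u} (hu : u ∈ U) :=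
    smooth_differentiableAt hU hf hu
  have pd3 (μ : Idx) {u} (hu : u ∈ U) : pd μ (fun u => P.ε / (4 * P.Lam0) * P.Phi K u ^ 2) u
      = P.ε / (4 * P.Lam0) * (2 * P.Phi K u * pd μ (P.Phi K) u) := by
    rw [pd_const_mul _ _ ((hd hΦ.smooth hu).fun_pow 2), pd_sq _ (hd hΦ.smooth hu)]
  constructor
  · exact hU
  · intro u hu
    have := (hK.gPrime_pos u hu).ne'
    simp [target, eta1, this]
  · intro u hu
    simp only [target, eta4_mul_h4Prime hK hu, hP.eps_mul_eta3_mul_A hu]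
  · intro u hu k
    unfold pdx
    rw [pd_sub _ (hd hP.smooth_n.smooth hu) (hd (hK.smoothX_shift hU).smooth hu)]
    simp [target, KerrChart.nPrime]
    ring
  · intro u hu k
    simp [target, KerrChart.wPrime]
  · exact hP.smooth_psi
  · exact ⟨contDiffOn_const.mul (hΦ.smooth.pow 2),
      fun u hu => by rw [pd3 _ hu, hΦ.indep3 u hu]; ring⟩
  · exact ⟨(hΦ'.smooth.pow 2).div hP.smooth_Xi.smooth hP.Xi_ne, fun u hu => by
      rw [hP.pd_sq_div_Xi hU hu hΦ'.smooth, hP.smooth_Xi.indep3 u hu, hΦ'.indep3 u hu]; simp⟩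
  · exact fun k => hn.pdx hU k
  · exact fun k => hP.smooth_A.pd hU _
  · exact fun u hu => mul_ne_zero
      (div_ne_zero hP.eps_ne (mul_ne_zero four_ne_zero hP.Lam0_ne)) (pow_ne_zero 2 (hP.Phi_ne hu))
  · exact fun u hu => div_ne_zero (pow_ne_zero 2 (hP.Phi_phi_ne hU hK hu)) (hP.Xi_ne u hu)
  · intro u hu k
    have h := hP.pdx_Phi hU hK hu k
    unfold pdx pdy at *
    rw [pd3 _ hu, pd3 _ hu, h]
    ring
  · intro u hu k
    have h0 := hP.Xi_ne u hu
    have h1 := hP.pdx_Xi hU hK hu k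
    -- The commutator term for ∂_φΦ̃, doubled by the square, is the source of 2 ∂_φw_k h₄; Ξ in the
    -- denominator is merely transported.
    have h2 := hP.pdx_pdy_of_transport hU hu hΦ.smooth (fun p hp => hP.pdx_Phi hU hK hp k)
    unfold pdx pdy at *
    rw [hP.pd_sq_div_Xi hU hu hΦ'.smooth, hP.pd_sq_div_Xi hU hu hΦ'.smooth, h1, h2]
    field_simp
    ring
  · exact fun u hu i j => pd_comm _ _ hU hn.smooth hu
  · exact fun u hu i j => hP.closed_w hU hK hu i j

/-- Write c = ε/(4Λ̃₀) and let primes denote ∂_φ. Then h₄′/(2h₄) = Φ̃″/Φ̃′ − Ξ′/(2Ξ), so h₃″ −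
h₃′²/(2h₃) − h₃′h₄′/(2h₄) collapses to cΦ̃Φ̃′Ξ′/Ξ. Inserting Ξ′ = 2 ᵛΛ Φ̃Φ̃′ makes it 2 ᵛΛ h₃h₄; the
constant c, and with it ε, drops out. -/
theorem solvesWithSource (hU : IsOpen U) (hK : K.Admissible U) (hP : P.Admissible K U) :
    (P.target K).SolvesWithSource U (fun u => -(Real.exp (-P.ψ u) * P.Lam u))
      (fun u => -P.vLam u) := by
  intro u hu β γ
  have H := hP.isLCMetric_target hU hK
  have hd {f : Pt → ℝ} (hf : ContDiffOn ℝ ∞ f U) {u} (hu : u ∈ U) :=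
    smooth_differentiableAt hU hf hu
  rcases β with i | a <;> rcases γ with j | b
  · rw [H.ricci_inl_inl hu, hP.poisson u hu]
    simp only [DMetric.source, H.g_eq u hu, Matrix.diagonal_apply]
    split_ifs
    · rw [Real.exp_neg]
      field_simp
    · ring
  · exact H.ricci_inl_inr hu _ _
  · exact H.ricci_inr_inl hu _ _
  · rw [H.ricci_inr_inr hu]
    refine congrArg (· * (P.target K).h u a b) ?_
    have hΦ := hP.smooth_Phi hU hK
    have hΦ' := smooth_pd (Sum.inr 1) hU hΦ
    have h1 {u} (hu : u ∈ U) : pdy 1 (fun u => P.ε / (4 * P.Lam0) * P.Phi K u ^ 2) u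
        = P.ε / (4 * P.Lam0) * 2 * P.Phi K u * pdy 1 (P.Phi K) u := by
      unfold pdy
      rw [pd_const_mul _ _ ((hd hΦ hu).fun_pow 2), pd_sq _ (hd hΦ hu)]
      ring
    have h2 : pdy 1 (pdy 1 (fun u => P.ε / (4 * P.Lam0) * P.Phi K u ^ 2)) u
        = P.ε / (4 * P.Lam0) * 2
          * (pdy 1 (P.Phi K) u ^ 2 + P.Phi K u * pdy 1 (pdy 1 (P.Phi K)) u) := by
      refine (pd_congr _ hU (fun p hp => h1 hp) hu).trans ?_
      rw [pd_mul _ ((hd hΦ hu).const_mul _) (hd hΦ' hu), pd_const_mul _ _ (hd hΦ hu)]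
      ring
    have h3 : pdy 1 (fun u => pdy 1 (P.Phi K) u ^ 2 / P.Xi u) u = _ :=
      hP.pd_sq_div_Xi hU hu hΦ' _
    have h4 : pd (Sum.inr 1) P.Xi u = _ := hP.Xi_phi hU hK hu
    rw [h2, h1 hu, h3, h4]
    have n1 := hP.Phi_ne hu
    have n2 := hP.Phi_phi_ne hU hK hu
    have n3 := hP.Xi_ne u hu
    have n4 := hP.Lam0_ne
    have n5 := hP.eps_ne
    field_simp
    ring

theorem pdy_Xi_div (hU : IsOpen U) (hK : K.Admissible U) (hP : P.Admissible K U) (hu : u ∈ U) :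
    pdy 1 (fun p => P.Xi p / (4 * P.Lam0 * K.A p)) u = P.vLam u * pdy 1 P.eta3 u := by
  have hA := hK.smoothX_A hU
  have hAd := smooth_differentiableAt hU hA.smooth hu
  have hA0 := hK.A_ne u hu
  have hL := hP.Lam0_ne
  have h1 := hP.Xi_phi hU hK hu
  have h2 := hP.two_mul_Phi_mul_pd hU hK hu (hA.indep4 u hu)
  unfold pdy at *
  rw [pd_div _ (smooth_differentiableAt hU hP.smooth_Xi.smooth hu) (hAd.const_mul _)
    (by simp [hA0, hL]), pd_const_mul _ _ hAd, hA.indep4 u hu, h1, h2]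
  field_simp
  ring

theorem eta4_eq (hU : IsOpen U) (hK : K.Admissible U) (hP : P.Admissible K U) (hu : u ∈ U) :
    P.eta4 K u = Real.sign (P.eta3 u) * K.A u * pdy 1 (fun p => Real.sqrt |P.eta3 p|) u ^ 2
      / ((K.A u * K.C u - K.B u ^ 2) * (P.Xi u / (4 * P.Lam0 * K.A u))) := by
  have he := hP.eta3_ne hu
  have hed := smooth_differentiableAt hU hP.smooth_eta3.smooth hu
  have hsd : DifferentiableAt ℝ (fun p => Real.sqrt |P.eta3 p|) u :=
    (hed.abs he).sqrt (abs_ne_zero.mpr he)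
  have hs (p : Pt) : Real.sqrt |P.eta3 p| ^ 2 = |P.eta3 p| := Real.sq_sqrt (abs_nonneg _)
  have hder : 4 * Real.sqrt |P.eta3 u| ^ 3 * pdy 1 (fun p => Real.sqrt |P.eta3 p|) u
      = 2 * P.eta3 u * pdy 1 P.eta3 u := by
    -- Both sides are the φ-derivative of η̃₃², once written through √|η̃₃|.
    have h : pdy 1 (fun p => (Real.sqrt |P.eta3 p| ^ 2) ^ 2) u
        = pdy 1 (fun p => P.eta3 p ^ 2) u := by simp only [hs, sq_abs]
    unfold pdy at *
    rw [pd_sq _ (hsd.fun_pow 2), pd_sq _ hsd, pd_sq _ hed] at h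
    linear_combination h
  have key := sign_mul_sq_of_sqrt_abs he (hs u) hder
  have hΦ : pdy 1 (P.Phi K) u ^ 2 = 4 * P.Lam0 * K.A u * pdy 1 P.eta3 u ^ 2 / (4 * P.eta3 u) := by
    have h1 := hP.two_mul_Phi_mul_pd hU hK hu ((hK.smoothX_A hU).indep4 u hu)
    have h2 := hP.Phi_sq hu
    have h0 := (hP.Phi_sq_pos u hu).ne'
    unfold pdy at *
    rw [eq_div_iff (by simpa using he)]
    refine mul_left_cancel₀ h0 ?_
    -- `h1` times the sum of its two sides is the squared relation; `h2` then trades Φ̃² for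
    -- 4Λ̃₀Āη̃₃.
    linear_combination (2 * P.Phi K u * pd (Sum.inr 1) (P.Phi K) u
      + 4 * P.Lam0 * K.A u * pd (Sum.inr 1) P.eta3 u) * P.eta3 u * h1
      - 4 * pd (Sum.inr 1) (P.Phi K) u ^ 2 * P.eta3 u * h2
  have hA := hK.A_ne u hu
  have hL := hP.Lam0_ne
  have hX := hP.Xi_ne u hu
  have hD := hK.disc_ne hu
  rw [mul_right_comm, key, eta4, hΦ, hK.h4Prime_eq hu]
  field_simp

end GenData.Admissible

end KerrSoliton

theorem mainTheorem3 (U : Set Pt) (hU : IsOpen U)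
    (K : KerrChart) (hK : K.Admissible U) (P : GenData) (hP : P.Admissible K U) :
    -- the prime data are those of the Kerr metric, in the nonholonomic coframe
    -- `dx¹, dx², dt + (B/A) dφ = dy³ + n̊_k dxᵏ + (B/A) dφ, dφ`
    (∀ u ∈ U, ∀ v : Pt,
      kerrLineElement K.m₀ K.a (K.r u) (K.ϑ u) (fderiv ℝ K.t u v) (fderiv ℝ K.r u v)
          (fderiv ℝ K.ϑ u v) (v (Sum.inr 1))
        = K.gPrime u * (v (Sum.inl 0) ^ 2 + v (Sum.inl 1) ^ 2)
          + K.A u * (v (Sum.inr 0) + ∑ k, K.nPrime k u * v (Sum.inl k)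
              + K.B u / K.A u * v (Sum.inr 1)) ^ 2
          + K.h4Prime u * v (Sum.inr 1) ^ 2) ∧
    -- the line element of the target metric
    (∀ u ∈ U, ∀ v : Pt,
      (P.target K).lineElement u v
        = Real.exp (P.ψ u) * (v (Sum.inl 0) ^ 2 + v (Sum.inl 1) ^ 2)
          + P.ε * (P.eta3 u * K.A u) * (v (Sum.inr 0)
              + ∑ k, (pdx k P.n u - pdx k K.shift u) * v (Sum.inl k)) ^ 2
          + P.eta4 K u * (K.C u - K.B u ^ 2 / K.A u) * (v (Sum.inr 1)
              + ∑ k, pdx k P.A u * v (Sum.inl k)) ^ 2) ∧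
    -- the polarization functions
    (∀ u ∈ U, Real.exp (P.ψ u) = P.eta1 K u * K.gPrime u ∧
      P.eta3 u = P.Phi K u ^ 2 / (4 * P.Lam0 * K.A u) ∧
      P.eta4 K u = pdy 1 (P.Phi K) u ^ 2 / (P.Xi u * (K.C u - K.B u ^ 2 / K.A u))) ∧
    -- `η̃₄` is computed from `η̃₃` and `ᵛΛ`
    (∀ u ∈ U,
      pdy 1 (fun p => P.Xi p / (4 * P.Lam0 * K.A p)) u = P.vLam u * pdy 1 P.eta3 u ∧
      P.eta4 K u = Real.sign (P.eta3 u) * K.A u * pdy 1 (fun p => Real.sqrt |P.eta3 p|) u ^ 2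
        / ((K.A u * K.C u - K.B u ^ 2) * (P.Xi u / (4 * P.Lam0 * K.A u)))) ∧
    -- Levi-Civita (zero torsion) configuration
    (P.target K).IsLCConfiguration U ∧
    -- Ricci soliton equations with the polarised sources
    (P.target K).SolvesWithSource U (fun u => -(Real.exp (-P.ψ u) * P.Lam u))
      (fun u => -P.vLam u) ∧
    (∀ (κ : Pt → ℝ) (lam : ℝ), (P.target K).IsGradientSoliton U κ lam ↔
      ∀ u ∈ U, ∀ β γ, (P.target K).hessian κ β γ u = lam * (P.target K).metric β γ u
        - (P.target K).source (fun u => -(Real.exp (-P.ψ u) * P.Lam u))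
            (fun u => -P.vLam u) β γ u) ∧
    -- Killing symmetry `∂/∂y³`
    (P.target K).IsKilling U (fun _ => Pi.single (Sum.inr 0) 1) := by
  have H := hP.isLCMetric_target hU hK
  have hR := hP.solvesWithSource hU hK
  refine ⟨fun u hu v => hK.kerrLineElement_eq hU hu v, fun u hu v => ?_, fun u hu => ⟨?_, ?_, rfl⟩,
    fun u hu => ⟨hP.pdy_Xi_div hU hK hu, hP.eta4_eq hU hK hu⟩, H.isLCConfiguration, hR,
    fun κ lam => ?_, H.isKilling⟩
  · have h : P.eta4 K u * (K.C u - K.B u ^ 2 / K.A u) = pdy 1 (P.Phi K) u ^ 2 / P.Xi u :=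
      GenData.Admissible.eta4_mul_h4Prime hK hu
    have hn (k : Fin 2) : pdx k (fun u => P.n u - K.shift u) u
        = pdx k P.n u - pdx k K.shift u :=
      pd_sub _ (smooth_differentiableAt hU hP.smooth_n.smooth hu)
        (smooth_differentiableAt hU (hK.smoothX_shift hU).smooth hu)
    rw [H.lineElement_eq hu, h, hP.eps_mul_eta3_mul_A hu]
    simp only [hn]
  · rw [GenData.eta1, div_mul_cancel₀ _ (hK.gPrime_pos u hu).ne']
  · rw [hP.Phi_sq hu, mul_div_cancel_left₀]
    exact mul_ne_zero (mul_ne_zero four_ne_zero hP.Lam0_ne) (hK.A_ne u hu)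
  · refine forall₂_congr fun u hu => forall₂_congr fun β γ => ?_
    -- Once the Ricci tensor is replaced by the source, the gradient equation is only rearranged.
    rw [hR u hu β γ, eq_sub_iff_add_eq']
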